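/- All Hilbert spaces are finite-dimensional. An isometry $V:\mathcal H_A\to\mathcal H_B\otimes\mathcal H_E$ generates the channel $\mathcal N(\rho)=\mathrm{Tr}_E(V\rho V^\dagger)$ and its complement $\mathcal N^c(\rho)=\mathrm{Tr}_B(V\rho V^\dagger)$. With $S(\rho)=-\mathrm{Tr}(\rho\log\rho)$, put $I_c(\rho,\mathcal N)=S(\mathcal N(\rho))-S(\mathcal N^c(\rho))$ and $\mathcal Q^{(1)}(\mathcal N)=\max_\rho I_c(\rho,\mathcal N)$, the maximum being over all states $\rho$ on $\mathcal H_A$. For $s,t\ge 0$ with $s+t\le 1$, the generalized Platypus channel $\mathcal N_{s,t}$ is generated by the isometry $F_{s,t}:\mathbb C^3\to\mathbb C^3\otimes\mathbb C^3$, $$F_{s,t}|0\rangle=\sqrt s\,|00\rangle+\sqrt{1-s-t}\,|11\rangle+\sqrt t\,|22\rangle,\quad F_{s,t}|1\rangle=|20\rangle,\quad F_{s,t}|2\rangle=|21\rangle .$$ For $\lambda\in[0,1]$, the qubit erasure channel is $\mathcal E_{2,\lambda}(\rho)=(1-\lambda)\rho+\lambda\,\mathrm{Tr}(\rho)\,|e\rangle\langle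 e|$, where $|e\rangle$ is a unit vector orthogonal to the input space; it is generated by $|i\rangle\mapsto\sqrt{1-\lambda}\,|i\rangle|e\rangle+\sqrt\lambda\,|e\rangle|i\rangle$, $i=0,1$. **Proposition.** Let $s>0$, $t\ge 0$, $s+t<1$ and $\mathcal Q^{(1)}(\mathcal N_{s,t})>0$. Then there is a unique $u_*=u_*(s,t)\in(0,1)$ such that $$\mathcal Q^{(1)}(\mathcal N_{s,t})=\begin{cases} I_c\big(u_*|0\rangle\langle 0|+(1-u_*)|2\rangle\langle 2|,\ \mathcal N_{s,t}\big), & s\le 1-s-t,\\ I_c\big(u_*|0\rangle\langle 0|+(1-u_*)|1\rangle\langle 1|,\ \mathcal N_{s,t}\big), & s\ge 1-s-t\end{cases}$$ (both equalities hold if $s=1-s-t$), and for every $\lambda\in[0,1]$ with $$\frac12\le\lambda<\begin{cases}\dfrac{1-(s+t)u_*}{1+u_*-2(s+t)u_*}, & s\le\frac{1-t}{2},\\[2mm] \dfrac{1-(1-s)u_*}{1+u_*-2(1-s)u_*}, & s\ge\frac{1-t}{2},\end{cases}$$ one has $$\mathcal Q^{(1)}(\mathcal N_{s,t}\otimes\mathcal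 E_{2,\lambda})>\mathcal Q^{(1)}(\mathcal N_{s,t}).$$ -/

import Mathlib

open scoped ComplexOrder Kronecker

/-- `ρ` is a quantum state (density operator): positive semidefinite of trace one. -/
def IsState {n : Type*} [Fintype n] (ρ : Matrix n n ℂ) : Prop :=
  ρ.PosSemidef ∧ ρ.trace = 1

open scoped Classical in
/-- The von Neumann entropy `S(ρ) = -Tr(ρ log ρ) = -∑ μ log μ`, the sum running over the
eigenvalues of the Hermitian matrix `ρ` with multiplicity (natural logarithm, `0 log 0 = 0`).
The value for non-Hermitian matrices is irrelevant and set to `0`. -/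
noncomputable def vnEntropy {n : Type*} [Fintype n] (ρ : Matrix n n ℂ) : ℝ :=
  if h : ρ.IsHermitian then ∑ i, Real.negMulLog (h.eigenvalues i) else 0

/-- The entropy of a state on an `n`-dimensional space lies in `[0, n]` (a crude bound). -/
theorem vnEntropy_mem {n : Type*} [Fintype n] {ρ : Matrix n n ℂ} (hρ : IsState ρ) :
    0 ≤ vnEntropy ρ ∧ vnEntropy ρ ≤ Fintype.card n := by
  classical
  have hH := hρ.1.isHermitian
  have h0 : ∀ i, 0 ≤ hH.eigenvalues i := hρ.1.eigenvalues_nonneg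
  have hsum : ∑ i, hH.eigenvalues i = 1 := by
    have h := hH.trace_eq_sum_eigenvalues
    rw [hρ.2] at h
    have h' := congrArg Complex.re h
    simpa using h'.symm
  have h1 : ∀ i, hH.eigenvalues i ≤ 1 := fun i =>
    hsum ▸ Finset.single_le_sum (fun j _ => h0 j) (Finset.mem_univ i)
  rw [vnEntropy, dif_pos hH]
  refine ⟨Finset.sum_nonneg fun i _ => Real.negMulLog_nonneg (h0 i) (h1 i), ?_⟩
  calc ∑ i, Real.negMulLog (hH.eigenvalues i) ≤ ∑ _i : n, (1 : ℝ) := by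
        refine Finset.sum_le_sum fun i _ => ?_
        have := Real.negMulLog_le_one_sub_self (h0 i)
        linarith [h0 i]
    _ = Fintype.card n := by simp

/-- The partial trace over the second tensor factor. -/
def traceSnd {β ε : Type*} [Fintype ε] (M : Matrix (β × ε) (β × ε) ℂ) : Matrix β β ℂ :=
  Matrix.of fun b b' => ∑ e, M (b, e) (b', e)

/-- The partial trace over the first tensor factor. -/
def traceFst {β ε : Type*} [Fintype β] (M : Matrix (β × ε) (β × ε) ℂ) : Matrix ε ε ℂ :=
  Matrix.of fun e e' => ∑ b, M (b, e) (b, e')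

/-- An isometry `V : H_A → H_B ⊗ H_E` between finite-dimensional spaces with orthonormal bases
indexed by `α`, `β`, `ε`.  It generates a complementary pair of quantum channels. -/
structure ChannelIsometry (α β ε : Type*) [Fintype α] [DecidableEq α] [Fintype β]
    [Fintype ε] where
  V : Matrix (β × ε) α ℂ
  isometry : V.conjTranspose * V = 1

namespace ChannelIsometry

variable {α β ε α' β' ε' : Type*}
  [Fintype α] [DecidableEq α] [Fintype β] [Fintype ε]
  [Fintype α'] [DecidableEq α'] [Fintype β'] [Fintype ε']

/-- The channel `N(ρ) = Tr_E (V ρ V†)`. -/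
def channel (N : ChannelIsometry α β ε) (ρ : Matrix α α ℂ) : Matrix β β ℂ :=
  traceSnd (N.V * ρ * N.V.conjTranspose)

/-- The complementary channel `Nᶜ(ρ) = Tr_B (V ρ V†)`. -/
def complement (N : ChannelIsometry α β ε) (ρ : Matrix α α ℂ) : Matrix ε ε ℂ :=
  traceFst (N.V * ρ * N.V.conjTranspose)

theorem isState_channel (N : ChannelIsometry α β ε) {ρ : Matrix α α ℂ} (hρ : IsState ρ) :
    IsState (N.channel ρ) := by
  have hP : (N.V * ρ * N.V.conjTranspose).PosSemidef := hρ.1.mul_mul_conjTranspose_same N.V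
  constructor
  · have h : N.channel ρ = ∑ e, (N.V * ρ * N.V.conjTranspose).submatrix (fun b => (b, e))
        (fun b => (b, e)) := by
      ext b b'
      simp [channel, traceSnd, Matrix.sum_apply]
    rw [h]
    exact Matrix.posSemidef_sum _ fun e _ => hP.submatrix _
  · have h : (N.channel ρ).trace = (N.V * ρ * N.V.conjTranspose).trace := by
      simp [channel, traceSnd, Matrix.trace, Fintype.sum_prod_type]
    rw [h, Matrix.trace_mul_comm, ← Matrix.mul_assoc, N.isometry, Matrix.one_mul, hρ.2]

theorem isState_complement (N : ChannelIsometry α β ε) {ρ : Matrix α α ℂ} (hρ : IsState ρ) :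
    IsState (N.complement ρ) := by
  have hP : (N.V * ρ * N.V.conjTranspose).PosSemidef := hρ.1.mul_mul_conjTranspose_same N.V
  constructor
  · have h : N.complement ρ = ∑ b, (N.V * ρ * N.V.conjTranspose).submatrix (fun e => (b, e))
        (fun e => (b, e)) := by
      ext e e'
      simp [complement, traceFst, Matrix.sum_apply]
    rw [h]
    exact Matrix.posSemidef_sum _ fun e _ => hP.submatrix _
  · have h : (N.complement ρ).trace = (N.V * ρ * N.V.conjTranspose).trace := by
      simp [complement, traceFst, Matrix.trace, Fintype.sum_prod_type_right]
    rw [h, Matrix.trace_mul_comm, ← Matrix.mul_assoc, N.isometry, Matrix.one_mul, hρ.2]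

/-- The coherent information `I_c(ρ, N) = S(N(ρ)) - S(Nᶜ(ρ))`. -/
noncomputable def coherentInfo (N : ChannelIsometry α β ε) (ρ : Matrix α α ℂ) : ℝ :=
  vnEntropy (N.channel ρ) - vnEntropy (N.complement ρ)

/-- The maximal coherent information `Q⁽¹⁾(N) = max_ρ I_c(ρ, N)` over all input states `ρ`. -/
noncomputable def maxCoherentInfo (N : ChannelIsometry α β ε) : ℝ :=
  sSup {x : ℝ | ∃ ρ : Matrix α α ℂ, IsState ρ ∧ x = N.coherentInfo ρ}

/-- The coherent information is bounded above, so `maxCoherentInfo` is a genuine supremum. -/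
theorem bddAbove_coherentInfo (N : ChannelIsometry α β ε) :
    BddAbove {x : ℝ | ∃ ρ : Matrix α α ℂ, IsState ρ ∧ x = N.coherentInfo ρ} := by
  refine ⟨Fintype.card β, ?_⟩
  rintro x ⟨ρ, hρ, rfl⟩
  have h1 := (vnEntropy_mem (N.isState_channel hρ)).2
  have h2 := (vnEntropy_mem (N.isState_complement hρ)).1
  unfold coherentInfo
  linarith

/-- The tensor product `N ⊗ M`, generated by `V_N ⊗ V_M` with the output factors `B`, `B'` and
the environment factors `E`, `E'` grouped together. -/
def tensor (N : ChannelIsometry α β ε) (M : ChannelIsometry α' β' ε') :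
    ChannelIsometry (α × α') (β × β') (ε × ε') where
  V := (N.V ⊗ₖ M.V).submatrix (Equiv.prodProdProdComm β β' ε ε') id
  isometry := by
    rw [Matrix.conjTranspose_submatrix, Matrix.submatrix_mul_equiv, Matrix.conjTranspose_kronecker,
      ← Matrix.mul_kronecker_mul, N.isometry, M.isometry, Matrix.one_kronecker_one]
    simp

/-- `(N ⊗ M)(ρ ⊗ σ) = N(ρ) ⊗ M(σ)`. -/
theorem tensor_channel (N : ChannelIsometry α β ε) (M : ChannelIsometry α' β' ε')
    (ρ : Matrix α α ℂ) (σ : Matrix α' α' ℂ) :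
    (N.tensor M).channel (ρ ⊗ₖ σ) = N.channel ρ ⊗ₖ M.channel σ := by
  have h : (N.tensor M).V * (ρ ⊗ₖ σ) * (N.tensor M).V.conjTranspose =
      ((N.V * ρ * N.V.conjTranspose) ⊗ₖ (M.V * σ * M.V.conjTranspose)).submatrix
        (Equiv.prodProdProdComm β β' ε ε') (Equiv.prodProdProdComm β β' ε ε') := by
    rw [Matrix.mul_kronecker_mul, Matrix.mul_kronecker_mul, ← Matrix.conjTranspose_kronecker]
    rfl
  ext ⟨b, b'⟩ ⟨c, c'⟩
  simp only [channel, h, traceSnd, Matrix.of_apply, Matrix.submatrix_apply,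
    Equiv.prodProdProdComm_apply, Matrix.kroneckerMap_apply, Fintype.sum_prod_type,
    Finset.sum_mul_sum]

end ChannelIsometry

/-- The isometry `F_{s,t}` of the generalized Platypus channel `N_{s,t}`:
`|0⟩ ↦ √s |00⟩ + √(1-s-t) |11⟩ + √t |22⟩`, `|1⟩ ↦ |20⟩`, `|2⟩ ↦ |21⟩`. -/
noncomputable def platypus (s t : ℝ) (hs : 0 ≤ s) (ht : 0 ≤ t) (hst : s + t ≤ 1) :
    ChannelIsometry (Fin 3) (Fin 3) (Fin 3) where
  V := Matrix.of fun p a =>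
    ![if p = (0, 0) then (√s : ℂ) else if p = (1, 1) then (√(1 - s - t) : ℂ)
        else if p = (2, 2) then (√t : ℂ) else 0,
      if p = (2, 0) then 1 else 0,
      if p = (2, 1) then 1 else 0] a
  isometry := by
    have h1 : ((√s : ℝ) : ℂ) * (√s : ℝ) = (s : ℝ) := by
      rw [← Complex.ofReal_mul, Real.mul_self_sqrt hs]
    have h2 : ((√t : ℝ) : ℂ) * (√t : ℝ) = (t : ℝ) := by
      rw [← Complex.ofReal_mul, Real.mul_self_sqrt ht]
    have h3 : ((√(1 - s - t) : ℝ) : ℂ) * (√(1 - s - t) : ℝ) = ((1 - s - t : ℝ) : ℂ) := by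
      rw [← Complex.ofReal_mul, Real.mul_self_sqrt (by linarith)]
    ext i j
    fin_cases i <;> fin_cases j <;>
      simp [Matrix.mul_apply, Fintype.sum_prod_type, Fin.sum_univ_three, h1, h2, h3]
    ring

/-- The matrix form of the generalized Platypus channel. -/
theorem platypus_channel (s t : ℝ) (hs : 0 ≤ s) (ht : 0 ≤ t) (hst : s + t ≤ 1)
    (ρ : Matrix (Fin 3) (Fin 3) ℂ) :
    (platypus s t hs ht hst).channel ρ =
      !![s * ρ 0 0, 0, √s * ρ 0 1;
         0, (1 - s - t) * ρ 0 0, √(1 - s - t) * ρ 0 2;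
         √s * ρ 1 0, √(1 - s - t) * ρ 2 0, t * ρ 0 0 + ρ 1 1 + ρ 2 2] := by
  have h1 : ((√s : ℝ) : ℂ) * (√s : ℝ) = (s : ℝ) := by
    rw [← Complex.ofReal_mul, Real.mul_self_sqrt hs]
  have h2 : ((√t : ℝ) : ℂ) * (√t : ℝ) = (t : ℝ) := by
    rw [← Complex.ofReal_mul, Real.mul_self_sqrt ht]
  have h3 : ((√(1 - s - t) : ℝ) : ℂ) * (√(1 - s - t) : ℝ) = 1 - s - t := by
    rw [← Complex.ofReal_mul, Real.mul_self_sqrt (by linarith)]; simp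
  ext i j
  fin_cases i <;> fin_cases j <;>
    simp [ChannelIsometry.channel, traceSnd, platypus, Matrix.mul_apply, Fin.sum_univ_three] <;>
    first
      | ring1
      | linear_combination (ρ 0 0) * h1
      | linear_combination (ρ 0 0) * h2
      | linear_combination (ρ 0 0) * h3

/-- The matrix form of its complementary channel. -/
theorem platypus_complement (s t : ℝ) (hs : 0 ≤ s) (ht : 0 ≤ t) (hst : s + t ≤ 1)
    (ρ : Matrix (Fin 3) (Fin 3) ℂ) :
    (platypus s t hs ht hst).complement ρ =
      !![s * ρ 0 0 + ρ 1 1, ρ 1 2, √t * ρ 1 0;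
         ρ 2 1, (1 - s - t) * ρ 0 0 + ρ 2 2, √t * ρ 2 0;
         √t * ρ 0 1, √t * ρ 0 2, t * ρ 0 0] := by
  have h1 : ((√s : ℝ) : ℂ) * (√s : ℝ) = (s : ℝ) := by
    rw [← Complex.ofReal_mul, Real.mul_self_sqrt hs]
  have h2 : ((√t : ℝ) : ℂ) * (√t : ℝ) = (t : ℝ) := by
    rw [← Complex.ofReal_mul, Real.mul_self_sqrt ht]
  have h3 : ((√(1 - s - t) : ℝ) : ℂ) * (√(1 - s - t) : ℝ) = 1 - s - t := by
    rw [← Complex.ofReal_mul, Real.mul_self_sqrt (by linarith)]; simp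
  ext i j
  fin_cases i <;> fin_cases j <;>
    simp [ChannelIsometry.complement, traceFst, platypus, Matrix.mul_apply, Fin.sum_univ_three] <;>
    first
      | ring1
      | linear_combination (ρ 0 0) * h1
      | linear_combination (ρ 0 0) * h2
      | linear_combination (ρ 0 0) * h3

/-- The isometry `|i⟩ ↦ √(1-r) |i⟩|e⟩ + √r |e⟩|i⟩` of the `d`-dimensional erasure channel with
erasure probability `r`.  The basis of the output space is `Option (Fin d)`, where `none` is the
erasure state `|e⟩`. -/
noncomputable def erasure (d : ℕ) (r : ℝ) (h0 : 0 ≤ r) (h1 : r ≤ 1) :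
    ChannelIsometry (Fin d) (Option (Fin d)) (Option (Fin d)) where
  V := Matrix.of fun p i =>
    if p = (some i, none) then (√(1 - r) : ℂ) else if p = (none, some i) then (√r : ℂ) else 0
  isometry := by
    have h2 : ((√r : ℝ) : ℂ) * (√r : ℝ) = (r : ℝ) := by
      rw [← Complex.ofReal_mul, Real.mul_self_sqrt h0]
    have h3 : ((√(1 - r) : ℝ) : ℂ) * (√(1 - r) : ℝ) = ((1 - r : ℝ) : ℂ) := by
      rw [← Complex.ofReal_mul, Real.mul_self_sqrt (by linarith)]
    ext i j
    by_cases hij : i = j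
    · subst hij
      simp [Matrix.mul_apply, Fintype.sum_prod_type, Fintype.sum_option, h2, h3]
    · simp [Matrix.mul_apply, Fintype.sum_prod_type, Fintype.sum_option, hij, Ne.symm hij]

/-- The channel generated by `erasure d r` is `ρ ↦ (1 - r) ρ + r Tr(ρ) |e⟩⟨e|`. -/
theorem erasure_channel (d : ℕ) (r : ℝ) (h0 : 0 ≤ r) (h1 : r ≤ 1) (ρ : Matrix (Fin d) (Fin d) ℂ) :
    (erasure d r h0 h1).channel ρ = Matrix.of fun b b' =>
      match b, b' with
      | some i, some j => (1 - r : ℂ) * ρ i j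
      | none, none => r * ρ.trace
      | _, _ => 0 := by
  have h2 : ((√r : ℝ) : ℂ) * (√r : ℝ) = (r : ℝ) := by
    rw [← Complex.ofReal_mul, Real.mul_self_sqrt h0]
  have h3 : ((√(1 - r) : ℝ) : ℂ) * (√(1 - r) : ℝ) = (1 - r : ℂ) := by
    rw [← Complex.ofReal_mul, Real.mul_self_sqrt (by linarith)]; simp
  ext b b'
  rcases b with _ | i <;> rcases b' with _ | j
  · simp [ChannelIsometry.channel, traceSnd, erasure, Matrix.mul_apply, Fintype.sum_option,
      Matrix.trace, Finset.mul_sum]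
    refine Finset.sum_congr rfl fun k _ => ?_
    simp only [apply_ite (starRingEnd ℂ), map_zero, Complex.conj_ofReal, mul_ite, mul_zero,
      Finset.sum_ite_eq, Finset.mem_univ, if_true]
    rw [← h2]; ring
  · simp [ChannelIsometry.channel, traceSnd, erasure, Matrix.mul_apply, Fintype.sum_option]
  · simp [ChannelIsometry.channel, traceSnd, erasure, Matrix.mul_apply, Fintype.sum_option]
  · simp [ChannelIsometry.channel, traceSnd, erasure, Matrix.mul_apply, Fintype.sum_option]
    simp only [apply_ite (starRingEnd ℂ), map_zero, Complex.conj_ofReal, mul_ite, mul_zero,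
      Finset.sum_ite_eq, Finset.mem_univ, if_true]
    rw [← h3]; ring

/-- `u ∈ (0,1)` is an optimal parameter for `N_{s,t}`: the maximal coherent information is attained
at `u|0⟩⟨0| + (1-u)|2⟩⟨2|` if `s ≤ 1-s-t`, and at `u|0⟩⟨0| + (1-u)|1⟩⟨1|` if `s ≥ 1-s-t`. -/
def IsOptimalParameter (s t : ℝ) (hs : 0 ≤ s) (ht : 0 ≤ t) (hst : s + t ≤ 1) (u : ℝ) : Prop :=
  0 < u ∧ u < 1 ∧
  (s ≤ 1 - s - t → (platypus s t hs ht hst).maxCoherentInfo =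
    (platypus s t hs ht hst).coherentInfo (Matrix.diagonal ![(u : ℂ), 0, 1 - u])) ∧
  (1 - s - t ≤ s → (platypus s t hs ht hst).maxCoherentInfo =
    (platypus s t hs ht hst).coherentInfo (Matrix.diagonal ![(u : ℂ), 1 - u, 0]))

/-!
Write `w = 1 - s - t` and `h x = -x log x`.

*Comparing entropies.* For families of nonnegative numbers of equal size and equal sum, the
difference of the entropies of the families shifted by `τ` has derivative `log` of the quotient of
the products `∏ (x i + τ)`, and it tends to `0` as `τ → ∞`.  Hence a pointwise inequality between
these products, that is, between the values `det (ρ + τ)`, implies an inequality between entropies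
(`sum_negMulLog_le_of_prod_add_le`).  Applied to the union of two spectra on each side, this compares
differences of entropies without diagonalizing anything.

*The one-shot optimum.* Relabelling basis vectors exchanges `s` and `w`
(`platypus_isRelabelling`), so let `s ≤ w`.  For a state `ρ` with `⟨0|ρ|0⟩ = u`, the determinants of
the output and of the environment are explicit polynomials in the entries of `ρ`, and positivity of
the principal minors of `ρ` yields two facts.  If `w ≤ t`, the environment is always the more
entropic side (`platypus_coherentInfo_nonpos`), so the maximal coherent information
is not positive.  If `t ≤ w`, the coherent information of `ρ` is at most that of
`u|0⟩⟨0| + (1-u)|2⟩⟨2|` (`platypus_coherentInfo_le_profile`).  As a function of `u` the latter is strictly concave when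
`t < w` and vanishes at `0` and `1`, so a positive maximum is attained at exactly one interior point.

*Superadditivity.* At the joint input `u|00⟩⟨00| + |v⟩⟨v|` with `v = √(1-u-y)|20⟩ + √y|11⟩`, the value
`y = 0` reproduces the optimum of the Platypus channel alone.  For small `y` the output acquires the
eigenvalue `(1-r) y`, while the environment acquires `r x`, where `y w u = x (m - x)` and
`m = 1 - (s+t)u`; all other eigenvalues vary smoothly.  To leading order the gain is
`((1-r) m / (w u) - r) h(x)`, and its coefficient is positive exactly below the stated threshold for
`r`.  Since `h` has infinite slope at `0`, this term wins (`eventually_lt_add_negMulLog`).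
-/

/-! ### Comparing entropies through characteristic polynomials -/

open Filter Topology in
/-- Shifting all points of two families with the same number of elements and the same sum far to
the right makes the difference of their entropies vanish. -/
theorem tendsto_sum_negMulLog_add_sub {ι κ : Type*} [Fintype ι] [Fintype κ]
    (hcard : Fintype.card ι = Fintype.card κ) (x : ι → ℝ) (y : κ → ℝ)
    (hsum : ∑ i, x i = ∑ j, y j) :
    Tendsto (fun τ : ℝ => ∑ j, Real.negMulLog (y j + τ) - ∑ i, Real.negMulLog (x i + τ))
      atTop (𝓝 0) := by
  have key : ∀ a : ℝ, Tendsto (fun τ : ℝ => Real.negMulLog (a + τ) + (a + τ) * Real.log τ)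
      atTop (𝓝 (-a)) := by
    intro a
    have h1 := Real.tendsto_mul_log_one_add_div_atTop a
    have h2 : Tendsto (fun τ : ℝ => a * Real.log (1 + a / τ)) atTop (𝓝 0) := by
      have h3 : Tendsto (fun τ : ℝ => 1 + a / τ) atTop (𝓝 1) := by
        simpa using (tendsto_const_nhds (x := (1 : ℝ))).add (tendsto_const_nhds.div_atTop tendsto_id)
      have h4 := (Real.continuousAt_log one_ne_zero).tendsto.comp h3
      simpa using h4.const_mul a
    have h5 := (h1.add h2).neg
    rw [add_zero] at h5
    refine h5.congr' ?_
    filter_upwards [eventually_gt_atTop 0, eventually_gt_atTop (-a)] with τ hτ hτ'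
    have h6 : 1 + a / τ = (a + τ) / τ := by field_simp; ring
    rw [h6, Real.log_div (by linarith) hτ.ne', Real.negMulLog]
    ring
  have hy := tendsto_finsetSum Finset.univ fun j _ => key (y j)
  have hx := tendsto_finsetSum Finset.univ fun i _ => key (x i)
  have h := hy.sub hx
  rw [Finset.sum_neg_distrib, Finset.sum_neg_distrib, hsum, sub_self] at h
  refine h.congr fun τ => ?_
  have hc : ∑ j, (y j + τ) = ∑ i, (x i + τ) := by
    simp [Finset.sum_add_distrib, hsum, hcard]
  rw [Finset.sum_add_distrib, Finset.sum_add_distrib, ← Finset.sum_mul, ← Finset.sum_mul, hc]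
  ring

/-- Among families of nonnegative numbers with the same number of elements and the same sum, the
entropy is monotone in the polynomial `∏ (x i + τ)`. -/
theorem sum_negMulLog_le_of_prod_add_le {ι κ : Type*} [Fintype ι] [Fintype κ]
    (hcard : Fintype.card ι = Fintype.card κ) {x : ι → ℝ} {y : κ → ℝ}
    (hx : ∀ i, 0 ≤ x i) (hy : ∀ j, 0 ≤ y j) (hsum : ∑ i, x i = ∑ j, y j)
    (hprod : ∀ τ : ℝ, 0 < τ → ∏ i, (x i + τ) ≤ ∏ j, (y j + τ)) :
    ∑ i, Real.negMulLog (x i) ≤ ∑ j, Real.negMulLog (y j) := by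
  set φ : ℝ → ℝ := fun τ => ∑ j, Real.negMulLog (y j + τ) - ∑ i, Real.negMulLog (x i + τ)
    with hφ
  have hderiv : ∀ τ : ℝ, 0 < τ → HasDerivAt φ
      (∑ j, (-Real.log (y j + τ) - 1) - ∑ i, (-Real.log (x i + τ) - 1)) τ := by
    intro τ hτ
    have hd : ∀ a : ℝ, 0 ≤ a → HasDerivAt (fun τ => Real.negMulLog (a + τ))
        (-Real.log (a + τ) - 1) τ := fun a ha =>
      (Real.hasDerivAt_negMulLog (by positivity)).comp_const_add a τ
    exact (HasDerivAt.fun_sum fun j _ => hd _ (hy j)).sub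
      (HasDerivAt.fun_sum fun i _ => hd _ (hx i))
  have hanti : AntitoneOn φ (Set.Ici 0) := by
    refine antitoneOn_of_deriv_nonpos (convex_Ici 0) ?_ ?_ ?_
    · refine Continuous.continuousOn ?_
      have := Real.continuous_negMulLog
      fun_prop
    · intro τ hτ
      rw [interior_Ici] at hτ
      exact (hderiv τ hτ).differentiableAt.differentiableWithinAt
    · intro τ hτ
      rw [interior_Ici] at hτ
      have hτ : 0 < τ := hτ
      rw [(hderiv τ hτ).deriv]
      have hlog := Real.log_le_log (Finset.prod_pos fun i _ => by have := hx i; positivity)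
        (hprod τ hτ)
      rw [Real.log_prod fun i _ => by have := hx i; positivity,
        Real.log_prod fun i _ => by have := hy i; positivity] at hlog
      simp only [Finset.sum_sub_distrib, Finset.sum_neg_distrib, Finset.sum_const,
        Finset.card_univ, hcard]
      linarith
  have h0 : 0 ≤ φ 0 := by
    refine le_of_tendsto (tendsto_sum_negMulLog_add_sub hcard x y hsum) ?_
    filter_upwards [Filter.eventually_ge_atTop 0] with τ hτ
    exact hanti (Set.mem_Ici.2 le_rfl) hτ hτ
  simpa [hφ] using h0

section vnEntropy

variable {n : Type*} [Fintype n]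

theorem Matrix.IsHermitian.ofReal_prod_eigenvalues_add [DecidableEq n] {ρ : Matrix n n ℂ}
    (hρ : ρ.IsHermitian) (τ : ℝ) :
    ((∏ i, (hρ.eigenvalues i + τ) : ℝ) : ℂ) = (ρ + (τ : ℂ) • 1).det := by
  have h := congrArg (Polynomial.eval (-(τ : ℂ))) hρ.charpoly_eq
  rw [Matrix.eval_charpoly, Polynomial.eval_prod] at h
  have h1 : Matrix.scalar n (-(τ : ℂ)) - ρ = -(ρ + (τ : ℂ) • 1) := by
    rw [Matrix.scalar_apply, ← Matrix.smul_one_eq_diagonal, neg_smul]; abel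
  rw [h1, Matrix.det_neg] at h
  have h2 : ∏ i, Polynomial.eval (-(τ : ℂ)) (Polynomial.X - Polynomial.C (hρ.eigenvalues i : ℂ))
      = (-1) ^ Fintype.card n * ∏ i, ((hρ.eigenvalues i : ℂ) + τ) := by
    rw [← Finset.card_univ, ← Finset.prod_const, ← Finset.prod_mul_distrib]
    exact Finset.prod_congr rfl fun i _ => by simp; ring
  have h3 := h.trans h2
  rw [mul_right_inj' (pow_ne_zero _ (by norm_num))] at h3
  rw [h3]; push_cast; rfl

/-- The spectrum of a positive semidefinite matrix, packaged with the three facts about it that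
enter entropy comparisons. -/
theorem exists_spectrum [DecidableEq n] {ρ : Matrix n n ℂ} (hρ : ρ.PosSemidef) :
    ∃ x : n → ℝ, (∀ i, 0 ≤ x i) ∧ ∑ i, x i = ρ.trace.re ∧
      (∀ τ : ℝ, ∏ i, (x i + τ) = (ρ + (τ : ℂ) • 1).det.re) ∧
      vnEntropy ρ = ∑ i, Real.negMulLog (x i) := by
  classical
  refine ⟨hρ.isHermitian.eigenvalues, hρ.eigenvalues_nonneg, ?_, fun τ => ?_, ?_⟩
  · rw [hρ.isHermitian.trace_eq_sum_eigenvalues]; simp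
  · rw [← hρ.isHermitian.ofReal_prod_eigenvalues_add τ, Complex.ofReal_re]
  · rw [vnEntropy, dif_pos hρ.isHermitian]
    congr!

/-- A positive semidefinite matrix has the entropy of any nonnegative family `d` with
`det (ρ + τ) = ∏ (d i + τ)`. -/
theorem vnEntropy_eq_of_det_add [DecidableEq n] {ρ : Matrix n n ℂ} (hρ : ρ.PosSemidef) {d : n → ℝ}
    (hd : ∀ i, 0 ≤ d i) (htr : ρ.trace.re = ∑ i, d i)
    (hdet : ∀ τ : ℝ, 0 < τ → (ρ + (τ : ℂ) • 1).det.re = ∏ i, (d i + τ)) :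
    vnEntropy ρ = ∑ i, Real.negMulLog (d i) := by
  obtain ⟨x, hx, hxs, hxp, hxe⟩ := exists_spectrum hρ
  rw [hxe]
  refine le_antisymm (sum_negMulLog_le_of_prod_add_le rfl hx hd (hxs.trans htr) ?_)
    (sum_negMulLog_le_of_prod_add_le rfl hd hx (hxs.trans htr).symm ?_)
  · intro τ hτ; rw [hxp, hdet τ hτ]
  · intro τ hτ; rw [hxp, hdet τ hτ]

theorem vnEntropy_diagonal [DecidableEq n] {d : n → ℝ} (hd : ∀ i, 0 ≤ d i) :
    vnEntropy (Matrix.diagonal fun i => (d i : ℂ)) = ∑ i, Real.negMulLog (d i) := by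
  refine vnEntropy_eq_of_det_add (Matrix.PosSemidef.diagonal fun i => ?_) hd ?_ fun τ _ => ?_
  · simpa using hd i
  · simp [Matrix.trace_diagonal]
  · rw [Matrix.smul_one_eq_diagonal, Matrix.diagonal_add, Matrix.det_diagonal]
    simp only [← Complex.ofReal_add, ← Complex.ofReal_prod, Complex.ofReal_re]

theorem vnEntropy_submatrix {m : Type*} [Fintype m] {ρ : Matrix n n ℂ} (hρ : ρ.PosSemidef)
    (e : m ≃ n) : vnEntropy (ρ.submatrix e e) = vnEntropy ρ := by
  classical
  obtain ⟨x, hx, hxs, hxp, hxe⟩ := exists_spectrum hρ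
  rw [hxe, vnEntropy_eq_of_det_add (d := x ∘ e) (hρ.submatrix e) (fun i => hx _)]
  · exact e.sum_comp fun i => Real.negMulLog (x i)
  · have h : (ρ.submatrix e e).trace = ρ.trace := e.sum_comp fun i => ρ i i
    rw [h, ← hxs]
    exact (e.sum_comp x).symm
  · intro τ _
    have h : ρ.submatrix e e + (τ : ℂ) • 1 = (ρ + (τ : ℂ) • 1).submatrix e e := by
      simp [Matrix.submatrix_add, Matrix.submatrix_smul]
    rw [h, Matrix.det_submatrix_equiv_self, ← hxp]
    exact (e.prod_comp fun i => x i + τ).symm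

end vnEntropy

/-! ### The one-shot coherent information of the Platypus channel -/

/-- The entries of a qutrit state, together with the signs of its principal minors. -/
theorem IsState.exists_entries {ρ : Matrix (Fin 3) (Fin 3) ℂ} (hρ : IsState ρ) :
    ∃ (u a b : ℝ) (x y z : ℂ),
      ρ = !![(u : ℂ), x, y; starRingEnd ℂ x, a, z; starRingEnd ℂ y, starRingEnd ℂ z, b] ∧
      0 ≤ u ∧ 0 ≤ a ∧ 0 ≤ b ∧ u + a + b = 1 ∧
      Complex.normSq x ≤ u * a ∧ Complex.normSq y ≤ u * b ∧ Complex.normSq z ≤ a * b ∧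
      0 ≤ u * (a * b - Complex.normSq z) - b * Complex.normSq x - a * Complex.normSq y +
        2 * (x * z * starRingEnd ℂ y).re := by
  have hH := hρ.1.isHermitian
  have hdiag : ∀ i, ((ρ i i).re : ℂ) = ρ i i := fun i => by
    rw [← Complex.conj_eq_iff_re]; exact hH.apply i i
  have hnn : ∀ i, 0 ≤ (ρ i i).re := fun i => (Complex.le_def.1 (hρ.1.diag_nonneg (i := i))).1
  have hminor : ∀ i j, Complex.normSq (ρ i j) ≤ (ρ i i).re * (ρ j j).re := by
    intro i j
    have h := (Complex.le_def.1 (hρ.1.submatrix ![i, j]).det_nonneg).1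
    rw [Matrix.det_fin_two] at h
    simp only [Matrix.submatrix_apply, Matrix.cons_val_zero, Matrix.cons_val_one] at h
    rw [← hH.apply j i, ← hdiag i, ← hdiag j] at h
    simp [Complex.normSq_apply] at h ⊢
    linarith
  have hdet := (Complex.le_def.1 hρ.1.det_nonneg).1
  have htr := congrArg Complex.re hρ.2
  have hent : ρ = !![((ρ 0 0).re : ℂ), ρ 0 1, ρ 0 2; starRingEnd ℂ (ρ 0 1), ((ρ 1 1).re : ℂ), ρ 1 2;
      starRingEnd ℂ (ρ 0 2), starRingEnd ℂ (ρ 1 2), ((ρ 2 2).re : ℂ)] := by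
    rw [hdiag, hdiag, hdiag]
    ext i j
    fin_cases i <;> fin_cases j <;> first | rfl | exact (hH.apply _ _).symm
  refine ⟨(ρ 0 0).re, (ρ 1 1).re, (ρ 2 2).re, ρ 0 1, ρ 0 2, ρ 1 2, hent, hnn _, hnn _, hnn _, ?_,
    hminor _ _, hminor _ _, hminor _ _, ?_⟩
  · simpa [Matrix.trace, Fin.sum_univ_three] using htr
  · rw [hent, Matrix.det_fin_three] at hdet
    simp [Complex.normSq_apply] at hdet ⊢
    linarith

theorem platypus_channel_det_add (s t : ℝ) (hs : 0 ≤ s) (ht : 0 ≤ t) (hst : s + t ≤ 1)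
    (u a b τ : ℝ) (x y z : ℂ) :
    ((platypus s t hs ht hst).channel
      !![(u : ℂ), x, y; starRingEnd ℂ x, a, z; starRingEnd ℂ y, starRingEnd ℂ z, b] +
        (τ : ℂ) • 1).det.re =
      (s * u + τ) * ((1 - s - t) * u + τ) * (t * u + a + b + τ) -
        s * Complex.normSq x * ((1 - s - t) * u + τ) -
        (1 - s - t) * Complex.normSq y * (s * u + τ) := by
  have h1 := Real.mul_self_sqrt hs
  have h2 := Real.mul_self_sqrt (show 0 ≤ 1 - s - t by linarith)
  rw [platypus_channel, Matrix.det_fin_three]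
  simp [Complex.normSq_apply]
  linear_combination (-(x.re * x.re + x.im * x.im) * ((1 - s - t) * u + τ)) * h1 -
    ((y.re * y.re + y.im * y.im) * (s * u + τ)) * h2

theorem platypus_complement_det_add (s t : ℝ) (hs : 0 ≤ s) (ht : 0 ≤ t) (hst : s + t ≤ 1)
    (u a b τ : ℝ) (x y z : ℂ) :
    ((platypus s t hs ht hst).complement
      !![(u : ℂ), x, y; starRingEnd ℂ x, a, z; starRingEnd ℂ y, starRingEnd ℂ z, b] +
        (τ : ℂ) • 1).det.re =
      (t * u + τ) * ((s * u + a + τ) * ((1 - s - t) * u + b + τ) - Complex.normSq z) -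
        t * (((1 - s - t) * u + b + τ) * Complex.normSq x + (s * u + a + τ) * Complex.normSq y -
          2 * (x * z * starRingEnd ℂ y).re) := by
  have h1 := Real.mul_self_sqrt ht
  rw [platypus_complement, Matrix.det_fin_three]
  simp [Complex.normSq_apply]
  linear_combination (-(((1 - s - t) * u + b + τ) * (x.re * x.re + x.im * x.im) +
    (s * u + a + τ) * (y.re * y.re + y.im * y.im) -
          2 * ((x.re * z.re - x.im * z.im) * y.re + (x.re * z.im + x.im * z.re) * y.im))) * h1

/-- In the notation of `platypus_coherentInfo_le_profile`, the product of the characteristic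
polynomials of the channel output for a state and of the environment for its diagonal competitor is
at most the product with the roles of the two states exchanged.  Here `k = |ρ₁₂|²`, `v = |ρ₀₁|²`,
`v' = |ρ₀₂|²`, and `q = 2 Re (ρ₀₁ρ₁₂ρ₂₀)` is the cubic term of `det ρ`. -/
theorem platypus_charpoly_mul_le {s w t u a b k v v' q τ : ℝ} (ht : 0 ≤ t)
    (hsw : s ≤ w) (htw : t ≤ w) (hs : 0 ≤ s) (hu : 0 ≤ u) (ha : 0 ≤ a) (hb : 0 ≤ b)
    (hv0 : 0 ≤ v) (hv'0 : 0 ≤ v')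
    (hv : v ≤ u * a) (hk : k ≤ a * b)
    (hdet : 0 ≤ u * (a * b - k) - b * v - a * v' + q) (hτ : 0 < τ) :
    ((s * u + τ) * (w * u + τ) * (t * u + a + b + τ) - s * v * (w * u + τ) -
        w * v' * (s * u + τ)) *
      ((s * u + τ) * (w * u + (a + b) + τ) * (t * u + τ)) ≤
    ((s * u + τ) * (w * u + τ) * (t * u + a + b + τ)) *
      ((t * u + τ) * ((s * u + a + τ) * (w * u + b + τ) - k) -
        t * ((w * u + b + τ) * v + (s * u + a + τ) * v' - q)) := by
  have hw : 0 ≤ w := hs.trans hsw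
  set X := s * u + τ with hX
  set Y := w * u + τ with hY
  set T := t * u + τ with hT
  have hX0 : 0 < X := by positivity
  have hY0 : 0 < Y := by positivity
  have hT0 : 0 < T := by positivity
  have hc : 0 ≤ a + b := by positivity
  -- The terms containing `k` and `q` are controlled by `det ρ ≥ 0`.
  have h1 : 0 ≤ T * (a * b - k) - t * (b * v + a * v' - q) := by
    have e1 : 0 ≤ τ * (a * b - k) := mul_nonneg hτ.le (by linarith)
    have e2 := mul_nonneg ht hdet
    rw [hT]; nlinarith
  have h2 : 0 ≤ (w - t) * Y * T + (a + b) * (w * T - t * Y) := by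
    have : w * T - t * Y = (w - t) * τ := by rw [hT, hY]; ring
    rw [this]
    have := sub_nonneg.2 htw
    positivity
  -- The coefficient of `v` may be negative; `v ≤ u * a` then compensates it.
  have h3 : 0 ≤ (T + (a + b)) * T * a * ((w - s) * u) +
      v * ((s - t) * Y * T + (a + b) * (s * T - t * Y)) := by
    have e2 : 0 ≤ T * (w - s) + (s - t) * Y := by
      have : T * (w - s) + (s - t) * Y = (w - t) * (s * u + τ) := by
        rw [hT, hY]; ring
      rw [this]; exact mul_nonneg (sub_nonneg.2 htw) hX0.le
    have e3 : 0 ≤ T * (w - s) + (s * T - t * Y) := by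
      have : T * (w - s) + (s * T - t * Y) = (w - t) * τ := by rw [hT, hY]; ring
      rw [this]; exact mul_nonneg (sub_nonneg.2 htw) hτ.le
    have e4 : 0 ≤ T * (T * (w - s) + (s - t) * Y) +
        (a + b) * (T * (w - s) + (s * T - t * Y)) := by positivity
    have e5 := mul_nonneg hv0 e4
    have e6 : 0 ≤ (u * a - v) * ((T + (a + b)) * T * (w - s)) := by
      have := sub_nonneg.2 hv
      have := sub_nonneg.2 hsw
      positivity
    nlinarith
  have hid : (X * Y * (T + (a + b))) *
      (T * ((X + a) * (Y + b) - k) - t * ((Y + b) * v + (X + a) * v' - q)) -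
      (X * Y * (T + (a + b)) - s * v * Y - w * v' * X) * (X * (Y + (a + b)) * T) =
      X * Y * ((T + (a + b)) * (T * (a * b - k) - t * (b * v + a * v' - q)) +
        ((T + (a + b)) * T * a * ((w - s) * u) +
          v * ((s - t) * Y * T + (a + b) * (s * T - t * Y)))) +
      v' * X * X * ((w - t) * Y * T + (a + b) * (w * T - t * Y)) := by
    have : (w - s) * u = Y - X := by rw [hX, hY]; ring
    rw [this]; ring
  have hfin : 0 ≤ X * Y * ((T + (a + b)) * (T * (a * b - k) - t * (b * v + a * v' - q)) +
        ((T + (a + b)) * T * a * ((w - s) * u) +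
          v * ((s - t) * Y * T + (a + b) * (s * T - t * Y)))) +
      v' * X * X * ((w - t) * Y * T + (a + b) * (w * T - t * Y)) := by positivity
  have r1 : t * u + a + b + τ = T + (a + b) := by rw [hT]; ring
  have r2 : w * u + (a + b) + τ = Y + (a + b) := by rw [hY]; ring
  have r3 : s * u + a + τ = X + a := by rw [hX]; ring
  have r4 : w * u + b + τ = Y + b := by rw [hY]; ring
  rw [r1, r2, r3, r4]
  linarith

/-- If `t` dominates the two other parameters, the characteristic polynomial of the environment
dominates that of the channel output. -/
theorem platypus_charpoly_le {s w t u a b k v v' q τ : ℝ}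
    (hsw : s ≤ w) (hwt : w ≤ t) (hs : 0 ≤ s) (hu : 0 ≤ u)
    (hv : v ≤ u * a) (hv' : v' ≤ u * b) (hk : k ≤ a * b)
    (hdet : 0 ≤ u * (a * b - k) - b * v - a * v' + q) (hτ : 0 < τ) :
    (s * u + τ) * (w * u + τ) * (t * u + a + b + τ) - s * v * (w * u + τ) -
        w * v' * (s * u + τ) ≤
      (t * u + τ) * ((s * u + a + τ) * (w * u + b + τ) - k) -
        t * ((w * u + b + τ) * v + (s * u + a + τ) * v' - q) := by
  have hw : 0 ≤ w := hs.trans hsw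
  have ht : 0 ≤ t := hw.trans hwt
  have h1 : 0 ≤ τ * (a * b - k) := mul_nonneg hτ.le (by linarith)
  have h2 := mul_nonneg ht hdet
  have h3 : 0 ≤ (t - s) * (w * u + τ) * (u * a - v) := by
    have := sub_nonneg.2 (hsw.trans hwt)
    have := sub_nonneg.2 hv
    positivity
  have h4 : 0 ≤ (t - w) * (s * u + τ) * (u * b - v') := by
    have := sub_nonneg.2 hwt
    have := sub_nonneg.2 hv'
    positivity
  nlinarith

/-- The coherent information of the Platypus channel at `u|0⟩⟨0| + (1-u)|2⟩⟨2|`; the eigenvalue `s u`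
shared by the output and the environment has been cancelled. -/
noncomputable def platypusProfile (s t u : ℝ) : ℝ :=
  Real.negMulLog ((1 - s - t) * u) + Real.negMulLog (1 - (1 - t) * u) -
    Real.negMulLog (1 - (s + t) * u) - Real.negMulLog (t * u)

theorem platypus_coherentInfo_diagonal {s t : ℝ} (hs : 0 ≤ s) (ht : 0 ≤ t) (hst : s + t ≤ 1)
    {u : ℝ} (hu0 : 0 ≤ u) (hu1 : u ≤ 1) :
    (platypus s t hs ht hst).coherentInfo (Matrix.diagonal ![(u : ℂ), 0, 1 - u]) =
      platypusProfile s t u := by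
  have hw : 0 ≤ 1 - s - t := by linarith
  have hB : (platypus s t hs ht hst).channel (Matrix.diagonal ![(u : ℂ), 0, 1 - u]) =
      Matrix.diagonal fun i => ((![s * u, (1 - s - t) * u, 1 - (1 - t) * u] i : ℝ) : ℂ) := by
    rw [platypus_channel]
    ext i j
    fin_cases i <;> fin_cases j <;> simp
    ring
  have hE : (platypus s t hs ht hst).complement (Matrix.diagonal ![(u : ℂ), 0, 1 - u]) =
      Matrix.diagonal fun i => ((![s * u, 1 - (s + t) * u, t * u] i : ℝ) : ℂ) := by
    rw [platypus_complement]
    ext i j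
    fin_cases i <;> fin_cases j <;> simp
    ring
  have h1 : 0 ≤ 1 - (1 - t) * u := by nlinarith
  have h2 : 0 ≤ 1 - (s + t) * u := by nlinarith
  rw [ChannelIsometry.coherentInfo, hB, hE, vnEntropy_diagonal, vnEntropy_diagonal]
  · simp only [Fin.sum_univ_three, platypusProfile]
    simp
    ring
  · intro i; fin_cases i
    · exact mul_nonneg hs hu0
    · exact h2
    · exact mul_nonneg ht hu0
  · intro i; fin_cases i
    · exact mul_nonneg hs hu0
    · exact mul_nonneg hw hu0
    · exact h1

/-- When `s` and `t` are at most `1 - s - t`, the state `u|0⟩⟨0| + (1-u)|2⟩⟨2|` is optimal among all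
states with the same population `u` of `|0⟩`. -/
theorem platypus_coherentInfo_le_profile {s t : ℝ} (hs : 0 ≤ s) (ht : 0 ≤ t) (hst : s + t ≤ 1)
    (hsw : s ≤ 1 - s - t) (htw : t ≤ 1 - s - t) {ρ : Matrix (Fin 3) (Fin 3) ℂ} (hρ : IsState ρ) :
    ∃ u, 0 ≤ u ∧ u ≤ 1 ∧
      (platypus s t hs ht hst).coherentInfo ρ ≤ platypusProfile s t u := by
  obtain ⟨u, a, b, x, y, z, rfl, hu, ha, hb, hsum, hx, hy, hz, hdet⟩ := hρ.exists_entries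
  refine ⟨u, hu, by linarith, ?_⟩
  have hw : 0 ≤ 1 - s - t := by linarith
  have hB := ((platypus s t hs ht hst).isState_channel hρ)
  have hE := ((platypus s t hs ht hst).isState_complement hρ)
  obtain ⟨p, hp0, hps, hpp, hpe⟩ := exists_spectrum hB.1
  obtain ⟨r, hr0, hrs, hrp, hre⟩ := exists_spectrum hE.1
  rw [hB.2] at hps
  rw [hE.2] at hrs
  have h1 : 0 ≤ 1 - (1 - t) * u := by nlinarith
  have h2 : 0 ≤ 1 - (s + t) * u := by nlinarith
  -- The inequality `S(B) + S(E') ≤ S(B') + S(E)`, where the primes denote the diagonal competitor.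
  have key := sum_negMulLog_le_of_prod_add_le
    (x := Sum.elim p ![s * u, 1 - (s + t) * u, t * u])
    (y := Sum.elim ![s * u, (1 - s - t) * u, 1 - (1 - t) * u] r) rfl ?_ ?_ ?_ ?_
  · rw [ChannelIsometry.coherentInfo, hpe, hre, platypusProfile]
    simp only [Fintype.sum_sum_type, Sum.elim_inl, Sum.elim_inr, Fin.sum_univ_three] at key ⊢
    simp at key
    linarith
  · rintro (i | i)
    · exact hp0 i
    · fin_cases i
      · exact mul_nonneg hs hu
      · exact h2
      · exact mul_nonneg ht hu
  · rintro (i | i)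
    · fin_cases i
      · exact mul_nonneg hs hu
      · exact mul_nonneg hw hu
      · exact h1
    · exact hr0 i
  · simp only [Fintype.sum_sum_type, Sum.elim_inl, Sum.elim_inr, hps, hrs]
    simp [Fin.sum_univ_three]
    ring
  · intro τ hτ
    simp only [Fintype.prod_sum_type, Sum.elim_inl, Sum.elim_inr, hpp, hrp]
    rw [platypus_channel_det_add, platypus_complement_det_add]
    have h := platypus_charpoly_mul_le (w := 1 - s - t) ht hsw htw hs hu ha hb
      (Complex.normSq_nonneg x) (Complex.normSq_nonneg y) hx hz hdet hτ
    simp only [Fin.prod_univ_three]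
    simp
    have e1 : 1 - (s + t) * u = (1 - s - t) * u + (a + b) := by linear_combination -hsum
    have e2 : 1 - (1 - t) * u = t * u + a + b := by linear_combination -hsum
    rw [e1, e2]
    simpa using h

/-- When `t ≥ 1 - s - t ≥ s`, no state has positive coherent information. -/
theorem platypus_coherentInfo_nonpos {s t : ℝ} (hs : 0 ≤ s) (ht : 0 ≤ t) (hst : s + t ≤ 1)
    (hsw : s ≤ 1 - s - t) (hwt : 1 - s - t ≤ t) {ρ : Matrix (Fin 3) (Fin 3) ℂ} (hρ : IsState ρ) :
    (platypus s t hs ht hst).coherentInfo ρ ≤ 0 := by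
  obtain ⟨u, a, b, x, y, z, rfl, hu, ha, hb, hsum, hx, hy, hz, hdet⟩ := hρ.exists_entries
  have hB := ((platypus s t hs ht hst).isState_channel hρ)
  have hE := ((platypus s t hs ht hst).isState_complement hρ)
  obtain ⟨p, hp0, hps, hpp, hpe⟩ := exists_spectrum hB.1
  obtain ⟨r, hr0, hrs, hrp, hre⟩ := exists_spectrum hE.1
  rw [hB.2] at hps
  rw [hE.2] at hrs
  rw [ChannelIsometry.coherentInfo, hpe, hre, sub_nonpos]
  refine sum_negMulLog_le_of_prod_add_le rfl hp0 hr0 (hps.trans hrs.symm) fun τ hτ => ?_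
  rw [hpp, hrp, platypus_channel_det_add, platypus_complement_det_add]
  exact platypus_charpoly_le hsw hwt hs hu hx hy hz hdet hτ

/-! ### Concavity of the profile and the unique optimum -/

theorem concaveOn_negMulLog_one_sub_mul_sub {c d : ℝ} (hc : c ≤ 1) (hd : 0 ≤ d) (hdc : d ≤ c) :
    ConcaveOn ℝ (Set.Icc (0 : ℝ) 1)
      (fun u => Real.negMulLog (1 - c * u) - Real.negMulLog (1 - d * u)) := by
  refine concaveOn_of_hasDerivWithinAt2_nonpos (convex_Icc 0 1)
    (f' := fun u => (-Real.log (1 - c * u) - 1) * -c - (-Real.log (1 - d * u) - 1) * -d)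
    (f'' := fun u => -(-c / (1 - c * u)) * -c - -(-d / (1 - d * u)) * -d) ?_ ?_ ?_ ?_
  · have := Real.continuous_negMulLog
    exact Continuous.continuousOn (by fun_prop)
  all_goals
    intro u hu
    rw [interior_Icc] at hu
    have h1 : 0 < 1 - c * u := by nlinarith [hu.1, hu.2]
    have h2 : 0 < 1 - d * u := by nlinarith [hu.1, hu.2]
    have hl : ∀ e : ℝ, HasDerivAt (fun u => 1 - e * u) (-e) u := fun e => by
      simpa using ((hasDerivAt_id u).const_mul e).const_sub 1
  · exact (((Real.hasDerivAt_negMulLog h1.ne').comp u (hl c)).sub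
      ((Real.hasDerivAt_negMulLog h2.ne').comp u (hl d))).hasDerivWithinAt
  · exact (((((hl c).log h1.ne').neg.sub_const 1).mul_const (-c)).sub
      ((((hl d).log h2.ne').neg.sub_const 1).mul_const (-d))).hasDerivWithinAt
  · have h3 : d / (1 - d * u) ≤ c / (1 - c * u) := by
      rw [div_le_div_iff₀ h2 h1]; nlinarith
    have h4 : 0 ≤ d / (1 - d * u) := by positivity
    have h5 : -(-c / (1 - c * u)) * -c - -(-d / (1 - d * u)) * -d =
      d / (1 - d * u) * d - c / (1 - c * u) * c := by ring
    rw [h5]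
    nlinarith [mul_le_mul h3 hdc hd (h4.trans h3)]

theorem continuous_platypusProfile (s t : ℝ) : Continuous (platypusProfile s t) := by
  have := Real.continuous_negMulLog
  unfold platypusProfile
  fun_prop

theorem strictConcaveOn_platypusProfile {s t : ℝ} (hs : 0 ≤ s) (ht : 0 ≤ t)
    (htw : t < 1 - s - t) : StrictConcaveOn ℝ (Set.Icc (0 : ℝ) 1) (platypusProfile s t) := by
  have hg := concaveOn_negMulLog_one_sub_mul_sub (c := 1 - t) (d := s + t) (by linarith)
    (by positivity) (by linarith)
  have hh := Real.strictConcaveOn_negMulLog.subset Set.Icc_subset_Ici_self (convex_Icc 0 1)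
  -- Since `h (c u) = u h(c) + c h(u)`, the strictly concave part of the profile is
  -- `(1 - s - 2 t) h(u)`.
  have hf : ∀ u, platypusProfile s t u = (1 - s - t - t) * Real.negMulLog u +
      u * (Real.negMulLog (1 - s - t) - Real.negMulLog t) +
      (Real.negMulLog (1 - (1 - t) * u) - Real.negMulLog (1 - (s + t) * u)) := by
    intro u
    rw [platypusProfile, Real.negMulLog_mul, Real.negMulLog_mul]
    ring
  refine ⟨convex_Icc 0 1, fun x hx y hy hxy p q hp hq hpq => ?_⟩
  have h1 := hh.2 hx hy hxy hp hq hpq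
  have h2 := hg.2 hx hy hp.le hq.le hpq
  rw [hf, hf, hf]
  simp only [smul_eq_mul] at h1 h2 ⊢
  nlinarith [mul_lt_mul_of_pos_left h1 (sub_pos.2 htw)]

theorem isState_diagonal_zero_two {u : ℝ} (hu0 : 0 ≤ u) (hu1 : u ≤ 1) :
    IsState (Matrix.diagonal ![(u : ℂ), 0, 1 - u]) := by
  refine ⟨Matrix.PosSemidef.diagonal fun i => ?_, by simp [Matrix.trace, Fin.sum_univ_three]⟩
  fin_cases i
  · simpa using hu0
  · simp
  · have : (0 : ℂ) ≤ ((1 - u : ℝ) : ℂ) := by exact_mod_cast sub_nonneg.2 hu1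
    simpa using this

namespace ChannelIsometry

variable {α β ε : Type*} [Fintype α] [DecidableEq α] [Fintype β] [Fintype ε]

theorem coherentInfo_le_maxCoherentInfo (N : ChannelIsometry α β ε) {ρ : Matrix α α ℂ}
    (hρ : IsState ρ) : N.coherentInfo ρ ≤ N.maxCoherentInfo :=
  le_csSup N.bddAbove_coherentInfo ⟨ρ, hρ, rfl⟩

theorem exists_isState_pos_of_maxCoherentInfo_pos (N : ChannelIsometry α β ε)
    (h : 0 < N.maxCoherentInfo) : ∃ ρ, IsState ρ ∧ 0 < N.coherentInfo ρ := by
  by_contra! hcon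
  refine h.not_ge (Real.sSup_nonpos ?_)
  rintro x ⟨ρ, hρ, rfl⟩
  exact hcon ρ hρ

end ChannelIsometry

/-- When `s ≤ 1 - s - t`, a positive maximal coherent information is the maximum of the profile, and
the maximizer is unique. -/
theorem platypus_exists_optimal {s t : ℝ} (hs : 0 ≤ s) (ht : 0 ≤ t) (hst : s + t ≤ 1)
    (hsw : s ≤ 1 - s - t) (hQ : 0 < (platypus s t hs ht hst).maxCoherentInfo) :
    ∃ u, 0 < u ∧ u < 1 ∧ (platypus s t hs ht hst).maxCoherentInfo = platypusProfile s t u ∧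
      ∀ v, 0 < v → v < 1 → (platypus s t hs ht hst).maxCoherentInfo = platypusProfile s t v →
        v = u := by
  set N := platypus s t hs ht hst with hN
  obtain ⟨ρ, hρ, hpos⟩ := N.exists_isState_pos_of_maxCoherentInfo_pos hQ
  have htw : t < 1 - s - t := by
    by_contra! hwt
    exact hpos.not_ge (platypus_coherentInfo_nonpos hs ht hst hsw hwt hρ)
  obtain ⟨u, hu, hmax⟩ := isCompact_Icc.exists_isMaxOn (Set.nonempty_Icc.2 zero_le_one)
    (continuous_platypusProfile s t).continuousOn
  have hle : ∀ v, 0 ≤ v → v ≤ 1 → platypusProfile s t v ≤ N.maxCoherentInfo := fun v h0 h1 => by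
    rw [← platypus_coherentInfo_diagonal hs ht hst h0 h1]
    exact N.coherentInfo_le_maxCoherentInfo (isState_diagonal_zero_two h0 h1)
  have hQu : N.maxCoherentInfo = platypusProfile s t u := by
    refine le_antisymm (csSup_le ⟨_, ρ, hρ, rfl⟩ ?_) (hle u hu.1 hu.2)
    rintro x ⟨σ, hσ, rfl⟩
    obtain ⟨v, hv0, hv1, hv⟩ := platypus_coherentInfo_le_profile hs ht hst hsw htw.le hσ
    exact hv.trans (hmax ⟨hv0, hv1⟩)
  -- The profile vanishes at both endpoints, so a positive maximum is attained inside.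
  have h0 : platypusProfile s t 0 = 0 := by simp [platypusProfile]
  have h1 : platypusProfile s t 1 = 0 := by
    rw [platypusProfile]
    have e1 : 1 - (1 - t) * 1 = t * 1 := by ring
    have e2 : 1 - (s + t) * 1 = (1 - s - t) * 1 := by ring
    rw [e1, e2]; ring
  rw [hQu] at hQ
  refine ⟨u, hu.1.lt_of_ne ?_, hu.2.lt_of_ne ?_, hQu, fun v hv0 hv1 hv => ?_⟩
  · rintro rfl; exact hQ.ne' h0
  · rintro rfl; exact hQ.ne' h1
  · refine (strictConcaveOn_platypusProfile hs ht htw).eq_of_isMaxOn ?_ hmax ⟨hv0.le, hv1.le⟩ hu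
    intro x hx
    show platypusProfile s t x ≤ platypusProfile s t v
    rw [← hv]
    exact hle x hx.1 hx.2

/-! ### Relabelling bases and exchanging `s` with `1 - s - t` -/

theorem IsState.submatrix {α : Type*} [Fintype α] {ρ : Matrix α α ℂ} (hρ : IsState ρ)
    (π : α ≃ α) : IsState (ρ.submatrix π π) :=
  ⟨hρ.1.submatrix π, (π.sum_comp fun i => ρ i i).trans hρ.2⟩

namespace ChannelIsometry

variable {α β ε α' β' ε' : Type*}
  [Fintype α] [DecidableEq α] [Fintype β] [Fintype ε]
  [Fintype α'] [DecidableEq α'] [Fintype β'] [Fintype ε']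

/-- Two channel isometries agree up to permutations of the input, output and environment bases. -/
def IsRelabelling (N N' : ChannelIsometry α β ε) (πα : α ≃ α) (πβ : β ≃ β) (πε : ε ≃ ε) : Prop :=
  N'.V = N.V.submatrix (Equiv.prodCongr πβ πε) πα

theorem IsRelabelling.coherentInfo_submatrix {N N' : ChannelIsometry α β ε} {πα : α ≃ α}
    {πβ : β ≃ β} {πε : ε ≃ ε} (h : IsRelabelling N N' πα πβ πε) {ρ : Matrix α α ℂ}
    (hρ : IsState ρ) : N'.coherentInfo (ρ.submatrix πα πα) = N.coherentInfo ρ := by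
  have hV : N'.V * ρ.submatrix πα πα * N'.V.conjTranspose =
      (N.V * ρ * N.V.conjTranspose).submatrix (Equiv.prodCongr πβ πε)
        (Equiv.prodCongr πβ πε) := by
    rw [h, Matrix.conjTranspose_submatrix, Matrix.submatrix_mul_equiv, Matrix.submatrix_mul_equiv]
  have hB : N'.channel (ρ.submatrix πα πα) = (N.channel ρ).submatrix πβ πβ := by
    ext b b'
    rw [channel, hV]
    exact πε.sum_comp fun e => (N.V * ρ * N.V.conjTranspose) (πβ b, e) (πβ b', e)
  have hE : N'.complement (ρ.submatrix πα πα) = (N.complement ρ).submatrix πε πε := by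
    ext e e'
    rw [complement, hV]
    exact πβ.sum_comp fun b => (N.V * ρ * N.V.conjTranspose) (b, πε e) (b, πε e')
  rw [coherentInfo, coherentInfo, hB, hE, vnEntropy_submatrix (N.isState_channel hρ).1,
    vnEntropy_submatrix (N.isState_complement hρ).1]

theorem IsRelabelling.maxCoherentInfo_eq {N N' : ChannelIsometry α β ε} {πα : α ≃ α}
    {πβ : β ≃ β} {πε : ε ≃ ε} (h : IsRelabelling N N' πα πβ πε) :
    N'.maxCoherentInfo = N.maxCoherentInfo := by
  rw [maxCoherentInfo, maxCoherentInfo]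
  congr 1
  ext x
  constructor
  · rintro ⟨ρ, hρ, rfl⟩
    refine ⟨ρ.submatrix πα.symm πα.symm, hρ.submatrix πα.symm, ?_⟩
    rw [← h.coherentInfo_submatrix (hρ.submatrix πα.symm)]
    simp
  · rintro ⟨ρ, hρ, rfl⟩
    exact ⟨ρ.submatrix πα πα, hρ.submatrix πα, (h.coherentInfo_submatrix hρ).symm⟩

theorem IsRelabelling.tensor {N N' : ChannelIsometry α β ε} {πα : α ≃ α}
    {πβ : β ≃ β} {πε : ε ≃ ε} (h : IsRelabelling N N' πα πβ πε) (M : ChannelIsometry α' β' ε') :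
    IsRelabelling (N.tensor M) (N'.tensor M) (πα.prodCongr (Equiv.refl _))
      (πβ.prodCongr (Equiv.refl _)) (πε.prodCongr (Equiv.refl _)) := by
  ext ⟨⟨b, b'⟩, ⟨e, e'⟩⟩ ⟨a, a'⟩
  have hV := congrFun₂ h (b, e) a
  simp only [ChannelIsometry.tensor, Matrix.submatrix_apply, Matrix.kroneckerMap_apply,
    Equiv.prodCongr_apply, Prod.map, Equiv.prodProdProdComm_apply, id, Equiv.refl_apply] at hV ⊢
  rw [hV]

end ChannelIsometry

/-- Exchanging `s` with `1 - s - t` amounts to exchanging the input states `|1⟩`, `|2⟩` and the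
states `|0⟩`, `|1⟩` of the output and of the environment. -/
theorem platypus_isRelabelling {s t : ℝ} (hs : 0 ≤ s) (ht : 0 ≤ t) (hst : s + t ≤ 1)
    (hs' : 0 ≤ 1 - s - t) (hst' : 1 - s - t + t ≤ 1) :
    ChannelIsometry.IsRelabelling (platypus s t hs ht hst) (platypus (1 - s - t) t hs' ht hst')
      (Equiv.swap 1 2) (Equiv.swap 0 1) (Equiv.swap 0 1) := by
  have e1 : Equiv.swap (1 : Fin 3) 2 0 = 0 := by decide
  have e2 : Equiv.swap (0 : Fin 3) 1 2 = 2 := by decide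
  have e3 : 1 - (1 - s - t) - t = s := by ring
  ext ⟨b, e⟩ a
  fin_cases b <;> fin_cases e <;> fin_cases a <;> simp [platypus, e1, e2, e3]

/-! ### Two analytic and linear algebraic facts -/

open Filter Topology in
/-- Near `0` the singularity `-x log x` beats every differentiable perturbation. -/
theorem eventually_lt_add_negMulLog {A p : ℝ → ℝ} {α β : ℝ} (hA : DifferentiableAt ℝ A 0)
    (hp : ContinuousAt p 0) (hβ : β < α * p 0) :
    ∀ᶠ x in 𝓝[>] (0 : ℝ),
      A 0 < A x + α * Real.negMulLog (x * p x) - β * Real.negMulLog x := by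
  have h1 : Tendsto (fun x => (A x - A 0) / x + α * Real.negMulLog (p x)) (𝓝[>] 0)
      (𝓝 (deriv A 0 + α * Real.negMulLog (p 0))) := by
    refine Tendsto.add ?_ ?_
    · have h := (hasDerivAt_iff_tendsto_slope.1 hA.hasDerivAt).mono_left
        (nhdsWithin_mono 0 fun x (hx : (0 : ℝ) < x) => hx.ne')
      refine h.congr fun x => ?_
      rw [slope_def_field, sub_zero]
    · exact ((Real.continuous_negMulLog.continuousAt.comp hp).tendsto.mono_left
        nhdsWithin_le_nhds).const_mul α
  have h2 : Tendsto (fun x => α * p x - β) (𝓝[>] 0) (𝓝 (α * p 0 - β)) :=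
    ((hp.tendsto.mono_left nhdsWithin_le_nhds).const_mul α).sub_const β
  have h3 : Tendsto (fun x => -Real.log x) (𝓝[>] 0) atTop :=
    tendsto_neg_atBot_atTop.comp Real.tendsto_log_nhdsGT_zero
  have h4 := (h3.atTop_mul_pos (sub_pos.2 hβ) h2).atTop_add h1
  filter_upwards [h4.eventually_gt_atTop 0, self_mem_nhdsWithin] with x hx hx0
  have hx0 : 0 < x := hx0
  have h5 := mul_pos hx0 hx
  have h6 : x * (-Real.log x * (α * p x - β) + ((A x - A 0) / x + α * Real.negMulLog (p x))) =
      A x + α * Real.negMulLog (x * p x) - β * Real.negMulLog x - A 0 := by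
    rw [Real.negMulLog_mul]
    have : x * ((A x - A 0) / x) = A x - A 0 := mul_div_cancel₀ _ hx0.ne'
    simp only [Real.negMulLog] at *
    linear_combination this
  linarith

/-- The matrix determinant lemma for a rank-one perturbation of an invertible diagonal matrix. -/
theorem Matrix.det_diagonal_add_vecMulVec {n : Type*} [Fintype n] [DecidableEq n] {D : n → ℂ}
    (hD : ∀ i, D i ≠ 0) (a b : n → ℂ) :
    (Matrix.diagonal D + Matrix.vecMulVec a b).det =
      (∏ i, D i) * (1 + ∑ i, b i * a i / D i) := by
  have hdet : IsUnit (Matrix.diagonal D).det := by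
    rw [Matrix.det_diagonal]
    exact (Finset.prod_ne_zero_iff.2 fun i _ => hD i).isUnit
  have hinv : (Matrix.diagonal D)⁻¹ = Matrix.diagonal fun i => (D i)⁻¹ := by
    refine Matrix.inv_eq_right_inv ?_
    rw [Matrix.diagonal_mul_diagonal, ← Matrix.diagonal_one]
    congr 1
    ext i
    exact mul_inv_cancel₀ (hD i)
  rw [Matrix.vecMulVec_eq Unit, Matrix.det_add_replicateCol_mul_replicateRow hdet, hinv,
    Matrix.det_diagonal, Matrix.det_unique]
  congr 1
  rw [Matrix.add_apply, Matrix.one_apply_eq, Matrix.mul_apply]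
  simp only [Matrix.mul_diagonal, Matrix.replicateRow_apply, Matrix.replicateCol_apply]
  congr 1
  exact Finset.sum_congr rfl fun i _ => by rw [div_eq_mul_inv]; ring

/-! ### Superadditivity with the erasure channel -/

namespace ChannelIsometry

variable {α β ε α' β' ε' : Type*}
  [Fintype α] [DecidableEq α] [Fintype β] [Fintype ε]
  [Fintype α'] [DecidableEq α'] [Fintype β'] [Fintype ε']

theorem channel_add (N : ChannelIsometry α β ε) (ρ σ : Matrix α α ℂ) :
    N.channel (ρ + σ) = N.channel ρ + N.channel σ := by
  ext b b'
  simp [channel, traceSnd, Matrix.mul_add, Matrix.add_mul, Finset.sum_add_distrib]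

theorem complement_add (N : ChannelIsometry α β ε) (ρ σ : Matrix α α ℂ) :
    N.complement (ρ + σ) = N.complement ρ + N.complement σ := by
  ext b b'
  simp [complement, traceFst, Matrix.mul_add, Matrix.add_mul, Finset.sum_add_distrib]

theorem tensor_complement (N : ChannelIsometry α β ε) (M : ChannelIsometry α' β' ε')
    (ρ : Matrix α α ℂ) (σ : Matrix α' α' ℂ) :
    (N.tensor M).complement (ρ ⊗ₖ σ) = N.complement ρ ⊗ₖ M.complement σ := by
  have h : (N.tensor M).V * (ρ ⊗ₖ σ) * (N.tensor M).V.conjTranspose =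
      ((N.V * ρ * N.V.conjTranspose) ⊗ₖ (M.V * σ * M.V.conjTranspose)).submatrix
        (Equiv.prodProdProdComm β β' ε ε') (Equiv.prodProdProdComm β β' ε ε') := by
    rw [Matrix.mul_kronecker_mul, Matrix.mul_kronecker_mul, ← Matrix.conjTranspose_kronecker]
    rfl
  ext ⟨b, b'⟩ ⟨c, c'⟩
  simp only [complement, h, traceFst, Matrix.of_apply, Matrix.submatrix_apply,
    Equiv.prodProdProdComm_apply, Matrix.kroneckerMap_apply, Fintype.sum_prod_type,
    Finset.sum_mul_sum]

end ChannelIsometry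

/-- The complement of an erasure channel is the erasure channel with the opposite probability. -/
theorem erasure_complement (d : ℕ) (r : ℝ) (h0 : 0 ≤ r) (h1 : r ≤ 1)
    (ρ : Matrix (Fin d) (Fin d) ℂ) :
    (erasure d r h0 h1).complement ρ =
      (erasure d (1 - r) (sub_nonneg.2 h1) (sub_le_self 1 h0)).channel ρ := by
  have hne : ∀ (i : Fin d) (e : Option (Fin d)) (b : Option (Fin d)),
      ((b, e) = (some i, none) ∧ (b, e) = (none, some i)) → False := by
    rintro i e b ⟨h, h'⟩
    rw [h] at h'
    simp at h'
  have hV : ∀ b e i, (erasure d r h0 h1).V (b, e) i =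
      (erasure d (1 - r) (sub_nonneg.2 h1) (sub_le_self 1 h0)).V (e, b) i := by
    intro b e i
    simp only [erasure, Matrix.of_apply, sub_sub_cancel, Prod.mk.injEq]
    have := hne i e b
    simp only [Prod.mk.injEq] at this
    split_ifs <;> first | rfl | tauto
  ext e e'
  simp [ChannelIsometry.complement, ChannelIsometry.channel, traceFst, traceSnd,
    Matrix.mul_apply, hV]

/-- The joint input `u|00⟩⟨00| + |v⟩⟨v|` with `v = √(1-u-y)|20⟩ + √y|11⟩`, written in blocks with
respect to the qubit. -/
noncomputable def jointState (u y : ℝ) : Matrix (Fin 3 × Fin 2) (Fin 3 × Fin 2) ℂ :=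
  Matrix.diagonal ![(u : ℂ), 0, ((1 - u - y : ℝ) : ℂ)] ⊗ₖ Matrix.single 0 0 1 +
    Matrix.diagonal ![0, (y : ℂ), 0] ⊗ₖ Matrix.single 1 1 1 +
    Matrix.single 2 1 ((√(1 - u - y) * √y : ℝ) : ℂ) ⊗ₖ Matrix.single 0 1 1 +
    Matrix.single 1 2 ((√(1 - u - y) * √y : ℝ) : ℂ) ⊗ₖ Matrix.single 1 0 1

theorem isState_jointState {u y : ℝ} (hu : 0 ≤ u) (hy : 0 ≤ y) (huy : 0 ≤ 1 - u - y) :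
    IsState (jointState u y) := by
  have h1 : ((√(1 - u - y) : ℝ) : ℂ) * (√(1 - u - y) : ℝ) = ((1 - u - y : ℝ) : ℂ) := by
    rw [← Complex.ofReal_mul, Real.mul_self_sqrt huy]
  have h2 : ((√y : ℝ) : ℂ) * (√y : ℝ) = (y : ℂ) := by
    rw [← Complex.ofReal_mul, Real.mul_self_sqrt hy]
  constructor
  · have h : jointState u y =
        Matrix.diagonal (fun p => if p = (0, 0) then (u : ℂ) else 0) +
        Matrix.vecMulVec
          (fun p => if p = (2, 0) then ((√(1 - u - y) : ℝ) : ℂ) else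
            if p = (1, 1) then ((√y : ℝ) : ℂ) else 0)
          (star fun p => if p = (2, 0) then ((√(1 - u - y) : ℝ) : ℂ) else
            if p = (1, 1) then ((√y : ℝ) : ℂ) else 0) := by
      ext ⟨i, k⟩ ⟨j, l⟩
      fin_cases i <;> fin_cases k <;> fin_cases j <;> fin_cases l <;>
        simp [jointState, Matrix.vecMulVec_apply,
          h1, h2, mul_comm, -Complex.ofReal_sub]
    rw [h]
    refine (Matrix.PosSemidef.diagonal fun p => ?_).add (Matrix.posSemidef_vecMulVec_self_star _)
    simp only [Pi.zero_apply]
    split_ifs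
    · exact_mod_cast hu
    · exact le_rfl
  · simp [jointState, Matrix.trace, Fintype.sum_prod_type, Fin.sum_univ_three, Matrix.single_apply]

theorem erasure_channel_single {r : ℝ} (h0 : 0 ≤ r) (h1 : r ≤ 1) (k : Fin 2) :
    (erasure 2 r h0 h1).channel (Matrix.single k k 1) =
      Matrix.diagonal fun o => o.elim (r : ℂ) fun l => if l = k then 1 - (r : ℂ) else 0 := by
  rw [erasure_channel]
  ext o o'
  fin_cases k <;> rcases o with _ | l <;> rcases o' with _ | l' <;>
    (try fin_cases l) <;> (try fin_cases l') <;> simp [Matrix.trace]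

theorem erasure_channel_single_of_ne {r : ℝ} (h0 : 0 ≤ r) (h1 : r ≤ 1) {k l : Fin 2}
    (hkl : k ≠ l) : (erasure 2 r h0 h1).channel (Matrix.single k l 1) =
      Matrix.single (some k) (some l) (1 - (r : ℂ)) := by
  rw [erasure_channel]
  ext o o'
  rcases o with _ | i <;> rcases o' with _ | j <;>
    simp [Matrix.trace_single_eq_of_ne _ _ _ hkl, Matrix.single_apply]

theorem platypus_tensor_erasure_channel_jointState {s t : ℝ} (hs : 0 ≤ s) (ht : 0 ≤ t)
    (hst : s + t ≤ 1) {r : ℝ} (h0 : 0 ≤ r) (h1 : r ≤ 1) (u y : ℝ) :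
    ((platypus s t hs ht hst).tensor (erasure 2 r h0 h1)).channel (jointState u y) =
      Matrix.diagonal fun p => ((p.2.elim
        (r * ![s * u, (1 - s - t) * u, 1 - (1 - t) * u] p.1)
        fun k => (1 - r) *
          ![![s * u, (1 - s - t) * u, t * u + (1 - u - y)], ![0, 0, y]] k p.1 : ℝ) : ℂ) := by
  have c1 : ∀ c : ℝ, (platypus s t hs ht hst).channel (Matrix.diagonal ![(u : ℂ), 0, (c : ℂ)]) =
      Matrix.diagonal ![(s * u : ℂ), (1 - s - t) * u, t * u + c] := fun c => by
    rw [platypus_channel]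
    ext i j; fin_cases i <;> fin_cases j <;> simp
  have c2 : (platypus s t hs ht hst).channel (Matrix.diagonal ![0, (y : ℂ), 0]) =
      Matrix.diagonal ![0, 0, (y : ℂ)] := by
    rw [platypus_channel]
    ext i j; fin_cases i <;> fin_cases j <;> simp
  have c3 : ∀ z : ℂ, (platypus s t hs ht hst).channel (Matrix.single 2 1 z) = 0 := fun z => by
    rw [platypus_channel]
    ext i j; fin_cases i <;> fin_cases j <;> simp
  have c4 : ∀ z : ℂ, (platypus s t hs ht hst).channel (Matrix.single 1 2 z) = 0 := fun z => by
    rw [platypus_channel]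
    ext i j; fin_cases i <;> fin_cases j <;> simp
  simp only [jointState, ChannelIsometry.channel_add, ChannelIsometry.tensor_channel, c1, c2, c3,
    c4, erasure_channel_single, Matrix.diagonal_kronecker_diagonal, Matrix.zero_kronecker,
    add_zero, Matrix.diagonal_add]
  congr 1
  ext ⟨i, k⟩
  rcases k with _ | k <;> fin_cases i <;> (try fin_cases k) <;> simp <;> ring

theorem platypus_tensor_erasure_complement_jointState {s t : ℝ} (hs : 0 ≤ s) (ht : 0 ≤ t)
    (hst : s + t ≤ 1) {r : ℝ} (h0 : 0 ≤ r) (h1 : r ≤ 1) {u y : ℝ} (hy : 0 ≤ y)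
    (huy : 0 ≤ 1 - u - y) :
    ((platypus s t hs ht hst).tensor (erasure 2 r h0 h1)).complement (jointState u y) =
      (Matrix.diagonal fun p => ((p.2.elim
        ((1 - r) * ![s * u + y, 1 - (s + t) * u - y, t * u] p.1)
        fun k => r * ![![s * u, (1 - s - t) * u, t * u], 0] k p.1 : ℝ) : ℂ)) +
      Matrix.vecMulVec
        (Pi.single (1, some 0) (r * (√(1 - u - y) : ℂ)) + Pi.single (0, some 1) (r * (√y : ℂ)))
        (Pi.single (1, some 0) (√(1 - u - y) : ℂ) + Pi.single (0, some 1) (√y : ℂ)) := by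
  have e1 : ((√(1 - u - y) : ℝ) : ℂ) * (√(1 - u - y) : ℝ) = ((1 - u - y : ℝ) : ℂ) := by
    rw [← Complex.ofReal_mul, Real.mul_self_sqrt huy]
  have e2 : ((√y : ℝ) : ℂ) * (√y : ℝ) = (y : ℂ) := by
    rw [← Complex.ofReal_mul, Real.mul_self_sqrt hy]
  have hvec : ∀ (p q : Fin 3 × Option (Fin 2)) (a b : ℂ),
      Matrix.vecMulVec (Pi.single p a) (Pi.single q b) = Matrix.single p q (a * b) := by
    intro p q a b
    ext i j
    simp only [Matrix.vecMulVec_apply, Matrix.single_apply, Pi.single_apply]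
    grind
  have c1 : ∀ c : ℝ, (platypus s t hs ht hst).complement
      (Matrix.diagonal ![(u : ℂ), 0, (c : ℂ)]) =
      Matrix.diagonal ![(s * u : ℂ), (1 - s - t) * u + c, t * u] := fun c => by
    rw [platypus_complement]
    ext i j; fin_cases i <;> fin_cases j <;> simp
  have c2 : (platypus s t hs ht hst).complement (Matrix.diagonal ![0, (y : ℂ), 0]) =
      Matrix.diagonal ![(y : ℂ), 0, 0] := by
    rw [platypus_complement]
    ext i j; fin_cases i <;> fin_cases j <;> simp
  have c3 : ∀ z : ℂ, (platypus s t hs ht hst).complement (Matrix.single 2 1 z) =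
      Matrix.single 1 0 z := fun z => by
    rw [platypus_complement]
    ext i j; fin_cases i <;> fin_cases j <;> simp
  have c4 : ∀ z : ℂ, (platypus s t hs ht hst).complement (Matrix.single 1 2 z) =
      Matrix.single 0 1 z := fun z => by
    rw [platypus_complement]
    ext i j; fin_cases i <;> fin_cases j <;> simp
  simp only [jointState, ChannelIsometry.complement_add, ChannelIsometry.tensor_complement]
  simp only [c1, c2, c3, c4, erasure_complement, erasure_channel_single, Matrix.diagonal_kronecker_diagonal,
    Matrix.diagonal_add, erasure_channel_single_of_ne _ _ (show (0 : Fin 2) ≠ 1 by decide),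
    erasure_channel_single_of_ne _ _ (show (1 : Fin 2) ≠ 0 by decide),
    Matrix.single_kronecker_single, Matrix.add_vecMulVec, Matrix.vecMulVec_add, hvec]
  have e3 : (r : ℂ) * (√y : ℂ) * (√(1 - u - y) : ℂ) =
      ((√(1 - u - y) * √y : ℝ) : ℂ) * (1 - ((1 - r : ℝ) : ℂ)) := by push_cast; ring
  have e4 : (r : ℂ) * (√(1 - u - y) : ℂ) * (√y : ℂ) =
      ((√(1 - u - y) * √y : ℝ) : ℂ) * (1 - ((1 - r : ℝ) : ℂ)) := by push_cast; ring
  rw [mul_assoc, e1, e3, e4, mul_assoc, e2]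
  set E : Fin 3 × Option (Fin 2) → ℂ := fun p => ((p.2.elim
        ((1 - r) * ![s * u + y, 1 - (s + t) * u - y, t * u] p.1)
        fun k => r * ![![s * u, (1 - s - t) * u, t * u], 0] k p.1 : ℝ) : ℂ) with hE
  have hdiag : ∀ D : Fin 3 × Option (Fin 2) → ℂ,
      (∀ i, D i = E i + Pi.single (M := fun _ => ℂ) (1, some 0) (r * ((1 - u - y : ℝ) : ℂ)) i +
        Pi.single (M := fun _ => ℂ) (0, some 1) (r * y : ℂ) i) →
      Matrix.diagonal D = Matrix.diagonal E +
        Matrix.single (1, some 0) (1, some 0) (r * ((1 - u - y : ℝ) : ℂ)) +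
        Matrix.single (0, some 1) (0, some 1) (r * y : ℂ) := by
    intro D h
    rw [← Matrix.diagonal_single, ← Matrix.diagonal_single, Matrix.diagonal_add,
      Matrix.diagonal_add, funext h]
  rw [hdiag _ ?_]
  · abel
  · rintro ⟨i, k⟩
    rcases k with _ | k <;> fin_cases i <;> (try fin_cases k) <;>
      simp [hE] <;> ring

/-- The environment spectrum at `jointState u y`.  When the qubit is erased, the coherent pair of
environment states contributes a `2 × 2` block of trace `m = 1 - (s+t)u` and determinant
`y (1-s-t) u`; its eigenvalues are parametrized as `x` and `m - x`. -/
theorem vnEntropy_complement_jointState {s t : ℝ} (hs : 0 ≤ s) (ht : 0 ≤ t)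
    (hst : s + t ≤ 1) {r : ℝ} (h0 : 0 ≤ r) (h1 : r ≤ 1) {u x y : ℝ} (hu : 0 ≤ u) (hy : 0 ≤ y)
    (huy : 0 ≤ 1 - u - y) (hx : 0 ≤ x) (hxm : x ≤ 1 - (s + t) * u)
    (hxy : y * ((1 - s - t) * u) = x * (1 - (s + t) * u - x)) :
    vnEntropy (((platypus s t hs ht hst).tensor (erasure 2 r h0 h1)).complement
      (jointState u y)) =
      ∑ p : Fin 3 × Option (Fin 2), Real.negMulLog (p.2.elim
        ((1 - r) * ![s * u + y, 1 - (s + t) * u - y, t * u] p.1)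
        fun k => r * ![![s * u, 1 - (s + t) * u - x, t * u], ![x, 0, 0]] k p.1) := by
  have hstate := (((platypus s t hs ht hst).tensor
    (erasure 2 r h0 h1)).isState_complement (isState_jointState hu hy huy))
  have hw : 0 ≤ 1 - s - t := by linarith
  have hr : 0 ≤ 1 - r := by linarith
  have hsu := mul_nonneg hs hu
  have htu := mul_nonneg ht hu
  have hwu := mul_nonneg hw hu
  have hmy : 0 ≤ 1 - (s + t) * u - y := by nlinarith
  have hmx : 0 ≤ 1 - (s + t) * u - x := by linarith
  refine vnEntropy_eq_of_det_add hstate.1 ?_ ?_ fun τ hτ => ?_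
  · rintro ⟨i, k⟩
    rcases k with _ | k <;> fin_cases i <;> (try fin_cases k) <;> simp <;> positivity
  · rw [hstate.2]
    simp [Fintype.sum_prod_type, Fintype.sum_option, Fin.sum_univ_three]
    ring
  have e1 : ((√(1 - u - y) : ℝ) : ℂ) * (√(1 - u - y) : ℝ) = ((1 - u - y : ℝ) : ℂ) := by
    rw [← Complex.ofReal_mul, Real.mul_self_sqrt huy]
  have e2 : ((√y : ℝ) : ℂ) * (√y : ℝ) = (y : ℂ) := by
    rw [← Complex.ofReal_mul, Real.mul_self_sqrt hy]
  set D : Fin 3 × Option (Fin 2) → ℝ := fun p => p.2.elim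
        ((1 - r) * ![s * u + y, 1 - (s + t) * u - y, t * u] p.1)
        fun k => r * ![![s * u, (1 - s - t) * u, t * u], 0] k p.1 with hD
  have hD0 : ∀ p, 0 ≤ D p := by
    rintro ⟨i, k⟩
    rcases k with _ | k <;> fin_cases i <;> (try fin_cases k) <;> simp [hD] <;> positivity
  rw [platypus_tensor_erasure_complement_jointState hs ht hst h0 h1 hy huy, add_right_comm,
    Matrix.smul_one_eq_diagonal, Matrix.diagonal_add, Matrix.det_diagonal_add_vecMulVec]
  swap
  · intro p
    rw [← Complex.ofReal_add]
    exact_mod_cast (add_pos_of_nonneg_of_pos (hD0 p) hτ).ne'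
  have hsum : ∑ p, ((Pi.single (1, some 0) (√(1 - u - y) : ℂ) + Pi.single (0, some 1) (√y : ℂ) :
        Fin 3 × Option (Fin 2) → ℂ) p *
      (Pi.single (1, some 0) (r * (√(1 - u - y) : ℂ)) + Pi.single (0, some 1) (r * (√y : ℂ)) :
        Fin 3 × Option (Fin 2) → ℂ) p) / ((D p : ℂ) + τ) =
      ((r * (1 - u - y) / (r * ((1 - s - t) * u) + τ) + r * y / τ : ℝ) : ℂ) := by
    simp only [Pi.add_apply, Fintype.sum_prod_type, Fintype.sum_option, Fin.sum_univ_three,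
      Fin.sum_univ_two, Pi.single_apply]
    simp [hD]
    rw [mul_left_comm, mul_left_comm _ (r : ℂ), e1, e2]
    push_cast
    ring
  rw [hsum, ← Complex.ofReal_one]
  simp only [← Complex.ofReal_add, ← Complex.ofReal_prod, ← Complex.ofReal_mul, Complex.ofReal_re]
  simp only [Fintype.prod_prod_type, Fintype.prod_option, Fin.prod_univ_three,
    Fin.prod_univ_two]
  simp
  have hp : 0 < r * ((1 - s - t) * u) + τ := by positivity
  have hblock : (r * ((1 - s - t) * u) + τ) * τ *
      (1 + (r * (1 - u - y) / (r * ((1 - s - t) * u) + τ) + r * y / τ)) =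
      (r * (1 - (s + t) * u - x) + τ) * (r * x + τ) := by
    field_simp
    linear_combination r ^ 2 * hxy
  linear_combination (((1 - r) * (s * u + y) + τ) * (r * (s * u) + τ) *
    ((1 - r) * (1 - (s + t) * u - y) + τ) * ((1 - r) * (t * u) + τ) * (r * (t * u) + τ) * τ *
      τ) * hblock

theorem platypus_tensor_erasure_coherentInfo_jointState {s t : ℝ} (hs : 0 ≤ s) (ht : 0 ≤ t)
    (hst : s + t ≤ 1) {r : ℝ} (h0 : 0 ≤ r) (h1 : r ≤ 1) {u x y : ℝ} (hu : 0 ≤ u) (hy : 0 ≤ y)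
    (huy : 0 ≤ 1 - u - y) (hx : 0 ≤ x) (hxm : x ≤ 1 - (s + t) * u)
    (hxy : y * ((1 - s - t) * u) = x * (1 - (s + t) * u - x)) :
    ((platypus s t hs ht hst).tensor (erasure 2 r h0 h1)).coherentInfo (jointState u y) =
      (1 - r) * (Real.negMulLog (s * u) + Real.negMulLog ((1 - s - t) * u) +
          Real.negMulLog (t * u + (1 - u - y)) - Real.negMulLog (s * u + y) -
          Real.negMulLog (1 - (s + t) * u - y) - Real.negMulLog (t * u)) +
        r * (Real.negMulLog ((1 - s - t) * u) + Real.negMulLog (1 - (1 - t) * u) -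
          Real.negMulLog (1 - (s + t) * u - x) - Real.negMulLog (t * u)) +
        (1 - r) * Real.negMulLog y - r * Real.negMulLog x := by
  have hw : 0 ≤ 1 - s - t := by linarith
  have hr : 0 ≤ 1 - r := by linarith
  have hsu := mul_nonneg hs hu
  have htu := mul_nonneg ht hu
  have hwu := mul_nonneg hw hu
  have hcu : 0 ≤ 1 - (1 - t) * u := by nlinarith
  rw [ChannelIsometry.coherentInfo, vnEntropy_complement_jointState hs ht hst h0 h1 hu hy huy hx
    hxm hxy, platypus_tensor_erasure_channel_jointState, vnEntropy_diagonal]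
  · simp only [Fintype.sum_prod_type, Fintype.sum_option, Fin.sum_univ_three, Fin.sum_univ_two]
    simp [Real.negMulLog_mul (1 - r), Real.negMulLog_mul r]
    ring
  · rintro ⟨i, k⟩
    rcases k with _ | k <;> fin_cases i <;> (try fin_cases k) <;> simp <;> positivity

/-- Joining the erasure channel strictly increases the maximal coherent information above the
profile value at `u`, provided the erasure probability is below the threshold. -/
theorem platypusProfile_lt_maxCoherentInfo_tensor {s t : ℝ} (hs : 0 < s) (ht : 0 ≤ t)
    (hst : s + t < 1) {r : ℝ} (h0 : 0 ≤ r) (h1 : r ≤ 1) {u : ℝ} (hu0 : 0 < u) (hu1 : u < 1)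
    (hr : r < (1 - (s + t) * u) / (1 + u - 2 * (s + t) * u)) :
    platypusProfile s t u <
      ((platypus s t hs.le ht hst.le).tensor (erasure 2 r h0 h1)).maxCoherentInfo := by
  have hw : 0 < 1 - s - t := by linarith
  have hwu : 0 < (1 - s - t) * u := mul_pos hw hu0
  set m := 1 - (s + t) * u with hm
  have hm0 : 0 < m := by nlinarith
  have hcu : 0 < t * u + (1 - u) := by nlinarith
  -- The eigenvalue `x` of the coherent block corresponds to the amplitude `y = x p(x)`.
  set p : ℝ → ℝ := fun x => (m - x) / ((1 - s - t) * u) with hp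
  have hpc : Continuous p := by fun_prop
  set A : ℝ → ℝ := fun x =>
    (1 - r) * (Real.negMulLog (s * u) + Real.negMulLog ((1 - s - t) * u) +
          Real.negMulLog (t * u + (1 - u - x * p x)) - Real.negMulLog (s * u + x * p x) -
          Real.negMulLog (m - x * p x) - Real.negMulLog (t * u)) +
        r * (Real.negMulLog ((1 - s - t) * u) + Real.negMulLog (1 - (1 - t) * u) -
          Real.negMulLog (m - x) - Real.negMulLog (t * u)) with hA
  have hA0 : A 0 = platypusProfile s t u := by
    have e : t * u + (1 - u) = 1 - (1 - t) * u := by ring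
    simp only [hA, platypusProfile, zero_mul, sub_zero, add_zero, e]
    ring
  have hAd : DifferentiableAt ℝ A 0 := by
    have hd : ∀ g : ℝ → ℝ, DifferentiableAt ℝ g 0 → g 0 ≠ 0 →
        DifferentiableAt ℝ (fun x => Real.negMulLog (g x)) 0 := fun g hg hg0 =>
      (Real.differentiableAt_negMulLog hg0).comp 0 hg
    have hpd : DifferentiableAt ℝ p 0 := by fun_prop
    have d1 := hd (fun x => t * u + (1 - u - x * p x)) (by fun_prop) (by simpa using hcu.ne')
    have d2 := hd (fun x => s * u + x * p x) (by fun_prop) (by simpa using ⟨hs.ne', hu0.ne'⟩)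
    have d3 := hd (fun x => m - x * p x) (by fun_prop) (by simpa using hm0.ne')
    have d4 := hd (fun x => m - x) (by fun_prop) (by simpa using hm0.ne')
    fun_prop
  have hrate : r < (1 - r) * p 0 := by
    have hden : 1 + u - 2 * (s + t) * u = m + (1 - s - t) * u := by rw [hm]; ring
    rw [hden, lt_div_iff₀ (by positivity)] at hr
    simp only [hp, sub_zero]
    rw [mul_div_assoc', lt_div_iff₀ hwu]
    linarith
  have hev := eventually_lt_add_negMulLog hAd hpc.continuousAt hrate
  have hsmall : ∀ᶠ x in nhdsWithin (0 : ℝ) (Set.Ioi 0), x * p x < 1 - u ∧ x < m := by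
    refine (Filter.Eventually.and ?_ ?_).filter_mono nhdsWithin_le_nhds
    · have hc : Continuous fun x => x * p x := by fun_prop
      exact hc.continuousAt.eventually_lt continuousAt_const (by simpa using hu1)
    · exact Iio_mem_nhds hm0
  obtain ⟨x, ⟨hx, hxy, hxm⟩, hx0⟩ := (hev.and hsmall).and self_mem_nhdsWithin |>.exists
  have hx0 : 0 < x := hx0
  have hp0 : 0 ≤ p x := div_nonneg (by linarith) hwu.le
  have hy0 : 0 ≤ x * p x := by positivity
  have hy1 : 0 ≤ 1 - u - x * p x := by linarith
  have hval := platypus_tensor_erasure_coherentInfo_jointState hs.le ht hst.le h0 h1 hu0.le hy0 hy1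
    hx0.le hxm.le (by simp only [hp]; rw [mul_assoc, div_mul_cancel₀ _ hwu.ne'])
  rw [← hA0]
  calc A 0 < _ := hx
    _ = _ := hval.symm
    _ ≤ _ := ChannelIsometry.coherentInfo_le_maxCoherentInfo _
      (isState_jointState hu0.le hy0 hy1)

/-! ### The optimal parameter -/

theorem platypus_coherentInfo_diagonal_swap {s t : ℝ} (hs : 0 ≤ s) (ht : 0 ≤ t)
    (hst : s + t ≤ 1) {u : ℝ} (hu0 : 0 ≤ u) (hu1 : u ≤ 1) :
    (platypus s t hs ht hst).coherentInfo (Matrix.diagonal ![(u : ℂ), 1 - u, 0]) =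
      platypusProfile (1 - s - t) t u := by
  have hρ : Matrix.diagonal ![(u : ℂ), 1 - u, 0] =
      (Matrix.diagonal ![(u : ℂ), 0, 1 - u]).submatrix (Equiv.swap 1 2) (Equiv.swap 1 2) := by
    have e : Equiv.swap (1 : Fin 3) 2 0 = 0 := by decide
    rw [Matrix.submatrix_diagonal_equiv]
    congr 1
    ext i
    fin_cases i <;> simp [e]
  have hρ' : (Matrix.diagonal ![(u : ℂ), 1 - u, 0]).submatrix (Equiv.swap 1 2) (Equiv.swap 1 2) =
      Matrix.diagonal ![(u : ℂ), 0, 1 - u] := by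
    rw [hρ]; simp [Function.comp_def]
  have h := (platypus_isRelabelling hs ht hst (by linarith) (by linarith)).coherentInfo_submatrix
    (hρ ▸ (isState_diagonal_zero_two hu0 hu1).submatrix (Equiv.swap 1 2))
  rw [← h, hρ', platypus_coherentInfo_diagonal _ _ _ hu0 hu1]

theorem isOptimalParameter_iff {s t : ℝ} (hs : 0 ≤ s) (ht : 0 ≤ t) (hst : s + t ≤ 1) (u : ℝ) :
    IsOptimalParameter s t hs ht hst u ↔ 0 < u ∧ u < 1 ∧
      (s ≤ 1 - s - t → (platypus s t hs ht hst).maxCoherentInfo = platypusProfile s t u) ∧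
      (1 - s - t ≤ s →
        (platypus s t hs ht hst).maxCoherentInfo = platypusProfile (1 - s - t) t u) := by
  rw [IsOptimalParameter]
  refine and_congr_right fun hu0 => and_congr_right fun hu1 => ?_
  rw [platypus_coherentInfo_diagonal hs ht hst hu0.le hu1.le,
    platypus_coherentInfo_diagonal_swap hs ht hst hu0.le hu1.le]

theorem mainTheorem6 (s t : ℝ) (hs : 0 < s) (ht : 0 ≤ t) (hst : s + t < 1)
    (hQ : 0 < (platypus s t hs.le ht hst.le).maxCoherentInfo) :
    (∃! u : ℝ, IsOptimalParameter s t hs.le ht hst.le u) ∧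
    ∀ u : ℝ, IsOptimalParameter s t hs.le ht hst.le u →
      ∀ (r : ℝ) (h0 : 0 ≤ r) (h1 : r ≤ 1), 1 / 2 ≤ r →
        (s ≤ (1 - t) / 2 → r < (1 - (s + t) * u) / (1 + u - 2 * (s + t) * u)) →
        ((1 - t) / 2 ≤ s → r < (1 - (1 - s) * u) / (1 + u - 2 * (1 - s) * u)) →
        (platypus s t hs.le ht hst.le).maxCoherentInfo <
          ((platypus s t hs.le ht hst.le).tensor (erasure 2 r h0 h1)).maxCoherentInfo := by
  rcases le_total s (1 - s - t) with hsw | hws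
  · have hiff : ∀ u, IsOptimalParameter s t hs.le ht hst.le u ↔ 0 < u ∧ u < 1 ∧
        (platypus s t hs.le ht hst.le).maxCoherentInfo = platypusProfile s t u := fun u => by
      rw [isOptimalParameter_iff]
      refine and_congr_right fun _ => and_congr_right fun _ => ⟨fun h => h.1 hsw, fun h =>
        ⟨fun _ => h, fun hws => ?_⟩⟩
      rw [h, ← le_antisymm hsw hws]
    constructor
    · obtain ⟨u, hu0, hu1, hu, huniq⟩ := platypus_exists_optimal hs.le ht hst.le hsw hQ
      refine ⟨u, (hiff u).2 ⟨hu0, hu1, hu⟩, fun v hv => ?_⟩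
      obtain ⟨hv0, hv1, hv⟩ := (hiff v).1 hv
      exact huniq v hv0 hv1 hv
    · intro u hu r h0 h1 _ hr _
      obtain ⟨hu0, hu1, hu⟩ := (hiff u).1 hu
      rw [hu]
      exact platypusProfile_lt_maxCoherentInfo_tensor hs ht hst h0 h1 hu0 hu1
        (hr (by linarith))
  · -- The case `1 - s - t ≤ s` reduces to the previous bounds for the relabelled channel.
    have hw : 0 < 1 - s - t := by linarith
    have hwt : 1 - s - t + t < 1 := by linarith
    have hrel := platypus_isRelabelling hs.le ht hst.le hw.le hwt.le
    have hiff : ∀ u, IsOptimalParameter s t hs.le ht hst.le u ↔ 0 < u ∧ u < 1 ∧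
        (platypus (1 - s - t) t hw.le ht hwt.le).maxCoherentInfo =
          platypusProfile (1 - s - t) t u := fun u => by
      rw [isOptimalParameter_iff, hrel.maxCoherentInfo_eq]
      refine and_congr_right fun _ => and_congr_right fun _ => ⟨fun h => h.2 hws, fun h =>
        ⟨fun hsw => ?_, fun _ => h⟩⟩
      rw [h, ← le_antisymm hsw hws]
    constructor
    · rw [← hrel.maxCoherentInfo_eq] at hQ
      obtain ⟨u, hu0, hu1, hu, huniq⟩ := platypus_exists_optimal hw.le ht hwt.le (by linarith) hQ
      refine ⟨u, (hiff u).2 ⟨hu0, hu1, hu⟩, fun v hv => ?_⟩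
      obtain ⟨hv0, hv1, hv⟩ := (hiff v).1 hv
      exact huniq v hv0 hv1 hv
    · intro u hu r h0 h1 _ _ hr
      obtain ⟨hu0, hu1, hu⟩ := (hiff u).1 hu
      rw [← hrel.maxCoherentInfo_eq, ← (hrel.tensor _).maxCoherentInfo_eq, hu]
      refine platypusProfile_lt_maxCoherentInfo_tensor hw ht hwt h0 h1 hu0 hu1 ?_
      have e : 1 - s - t + t = 1 - s := by ring
      rw [e]
      exact hr (by linarith)
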